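/- Notation. For $\xi\in\mathbf R^3$ let $v(\xi)=\xi/\sqrt{1+|\xi|^2}$, let $\Box_{t,x}=\partial_t^2-\Delta_x$, and let $(-\Delta_x)^{-1}\rho(x)=\int_{\mathbf R^3}\frac{\rho(y)}{4\pi|x-y|}\,dy$. Put $\rho_f(t,x)=\int_{\mathbf R^3} f(t,x,\xi)\,d\xi$ and $j_f(t,x)=\int_{\mathbf R^3} v(\xi)f(t,x,\xi)\,d\xi$. Let $T>0$, let $f\in C_c^\infty([0,T]\times\mathbf R^3\times\mathbf R^3)$ be real-valued, let $f^{in}=f|_{t=0}$ and $\phi^{in}=(-\Delta_x)^{-1}\int_{\mathbf R^3} f^{in}\,d\xi$, and let $\phi_0$ be the classical solution on $[0,T]\times\mathbf R^3$ of $$\Box_{t,x}\phi_0=0,\qquad \phi_0|_{t=0}=\phi^{in},\qquad \partial_t\phi_0|_{t=0}=0 .$$ Suppose that $(f,u)$, with $u=u(t,x,\xi)\in\mathbf R$, satisfies the scalar formulation of the Vlasov--Maxwell system on $[0,T]\times\mathbf R^3\times\mathbf R^3$: $$\partial_tf+v(\xi)\cdot\nabla_xf+(E+v(\xi)\wedge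 B)\cdot\nabla_\xi f=0,\qquad \Box_{t,x}u=f,$$ $$\phi=\phi_0+\int_{\mathbf R^3}u\,d\xi,\qquad A=\int_{\mathbf R^3}v(\xi)u\,d\xi,\qquad B=\operatorname{curl}_xA,\qquad E=-\partial_tA-\nabla_x\phi,$$ with initial data $f|_{t=0}=f^{in}$ and $u|_{t=0}=\partial_tu|_{t=0}=0$, where for each $\xi$ the function $u(\cdot,\cdot,\xi)$ is a classical solution of the wave equation. (A classical solution is of class $C^1$ on $[0,T]\times\mathbf R^3$, of class $C^2$ on $(0,T)\times\mathbf R^3$, and satisfies the equation on $(0,T)\times\mathbf R^3$ and the initial conditions at $t=0$. At $t=0$ and $t=T$ time derivatives are one-sided.) Then the integrals defining $\phi$ and $A$ converge absolutely, $\phi$ and $A$ are of class $C^\infty$ on $[0,T]\times\mathbf R^3$, and they satisfy the Lorentz gauge condition $$\partial_t\phi+\operatorname{div}_xA=0\quad\text{on }[0,T]\times\mathbf R^3 .$$ Moreover, $(f,E,B)$ is a $C^1$ solution on $[0,T]$ of the Vlasov--Maxwell system $$\partial_tf+v(\xi)\cdot\nabla_xf+(E+v(\xi)\wedge B)\cdot\nabla_\xi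 f=0,$$ $$\operatorname{div}_xB=0,\qquad \partial_tB+\operatorname{curl}_xE=0,\qquad \operatorname{div}_xE=\rho_f,\qquad \partial_tE-\operatorname{curl}_xB=-j_f,$$ with initial data $$f|_{t=0}=f^{in},\qquad E|_{t=0}=-\nabla_x\phi^{in}=-\nabla_x(-\Delta_x)^{-1}\int_{\mathbf R^3} f^{in}\,d\xi,\qquad B|_{t=0}=0 .$$ -/

import Mathlib

open Set MeasureTheory
open scoped ContDiff

noncomputable section

namespace VlasovMaxwell

/-- Euclidean space of dimension three, used for positions and for momenta. -/
abbrev E3 : Type := EuclideanSpace ℝ (Fin 3)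

/-! ### Differential operators -/

/-- The cross product of two vectors of Euclidean space. -/
def cross (a b : E3) : E3 := WithLp.toLp 2 (crossProduct a.ofLp b.ofLp)

/-- The partial derivative in the `i`-th space direction. -/
def partialDeriv (i : Fin 3) (g : E3 → ℝ) (x : E3) : ℝ :=
  fderiv ℝ g x (EuclideanSpace.single i 1)

/-- The divergence of a vector field. -/
def divergence (F : E3 → E3) (x : E3) : ℝ :=
  ∑ i : Fin 3, partialDeriv i (fun y => F y i) x

/-- The curl of a vector field. -/
def curl (F : E3 → E3) (x : E3) : E3 :=
  !₂[partialDeriv 1 (fun y => F y 2) x - partialDeriv 2 (fun y => F y 1) x,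
     partialDeriv 2 (fun y => F y 0) x - partialDeriv 0 (fun y => F y 2) x,
     partialDeriv 0 (fun y => F y 1) x - partialDeriv 1 (fun y => F y 0) x]

/-- The time derivative on the time interval `[0, T]` (one-sided at the two end points). -/
def timeDeriv {F : Type*} [NormedAddCommGroup F] [NormedSpace ℝ F]
    (T : ℝ) (w : ℝ → E3 → F) (t : ℝ) (x : E3) : F :=
  derivWithin (fun s => w s x) (Icc 0 T) t

/-- The d'Alembert operator `∂ₜ² - Δ`. -/
def dAlembert (T : ℝ) (w : ℝ → E3 → ℝ) (t : ℝ) (x : E3) : ℝ :=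
  timeDeriv T (timeDeriv T w) t x - Laplacian.laplacian (w t) x

/-- The closed slab `[0, T] × ℝ³`. -/
def slab (T : ℝ) : Set (ℝ × E3) := Icc 0 T ×ˢ univ

/-- The closed phase space slab `[0, T] × ℝ³ × ℝ³`. -/
def phaseSlab (T : ℝ) : Set (ℝ × E3 × E3) := Icc 0 T ×ˢ univ

/-! ### Kinetic quantities -/

/-- The relativistic velocity `v(ξ) = ξ / √(1 + |ξ|²)` of a particle of momentum `ξ`. -/
def velocity (ξ : E3) : E3 := (Real.sqrt (1 + ‖ξ‖ ^ 2))⁻¹ • ξ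

/-- The charge density `∫ f dξ` of a distribution function at a given time. -/
def chargeDensity (f : E3 → E3 → ℝ) (x : E3) : ℝ := ∫ ξ, f x ξ

/-- The current density `∫ v(ξ) f dξ` of a distribution function at a given time. -/
def currentDensity (f : E3 → E3 → ℝ) (x : E3) : E3 := ∫ ξ, f x ξ • velocity ξ

/-- The Newtonian potential `(-Δ)⁻¹ ρ`, i.e. the convolution of `ρ` with the fundamental
solution `1 / (4π|x|)` of `-Δ`. -/
def newtonPotential (ρ : E3 → ℝ) (x : E3) : ℝ :=
  ∫ y, (4 * Real.pi * ‖x - y‖)⁻¹ * ρ y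

/-- The space `C_c^∞([0, T] × ℝ³ × ℝ³)`: smooth up to the boundary of the slab, and vanishing on
the slab outside a compact set. The values for times outside `[0, T]` play no role. -/
structure IsSmoothCompactlySupported (T : ℝ) (f : ℝ → E3 → E3 → ℝ) : Prop where
  smooth : ContDiffOn ℝ ∞ (fun p : ℝ × E3 × E3 => f p.1 p.2.1 p.2.2) (phaseSlab T)
  support : ∃ K : Set (ℝ × E3 × E3), IsCompact K ∧
    ∀ p ∈ phaseSlab T, p ∉ K → f p.1 p.2.1 p.2.2 = 0

/-- The Vlasov equation `∂ₜf + v(ξ)·∇ₓf + (E + v(ξ) × B)·∇_ξ f = 0` on `[0, T] × ℝ³ × ℝ³`. -/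
def VlasovEquation (T : ℝ) (f : ℝ → E3 → E3 → ℝ) (E B : ℝ → E3 → E3) : Prop :=
  ∀ t ∈ Icc 0 T, ∀ x ξ : E3,
    timeDeriv T (fun s y => f s y ξ) t x
      + inner ℝ (velocity ξ) (gradient (fun y => f t y ξ) x)
      + inner ℝ (E t x + cross (velocity ξ) (B t x)) (gradient (fun η => f t x η) ξ) = 0

/-! ### The Cauchy problem for the wave equation -/

/-- `w` is a classical solution on `[0, T] × ℝ³` of the Cauchy problem `□w = h`, `w = w₀` and
`∂ₜw = w₁` at `t = 0`: it is `C¹` up to the boundary of the slab, `C²` in its interior, and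
satisfies the equation there. -/
structure IsWaveSolution (T : ℝ) (h : ℝ → E3 → ℝ) (w₀ w₁ : E3 → ℝ) (w : ℝ → E3 → ℝ) : Prop where
  contDiffOn_one : ContDiffOn ℝ 1 (fun p : ℝ × E3 => w p.1 p.2) (slab T)
  contDiffOn_two : ContDiffOn ℝ 2 (fun p : ℝ × E3 => w p.1 p.2) (Ioo 0 T ×ˢ univ)
  equation : ∀ t ∈ Ioo 0 T, ∀ x : E3, dAlembert T w t x = h t x
  initial : ∀ x : E3, w 0 x = w₀ x
  initial_timeDeriv : ∀ x : E3, timeDeriv T w 0 x = w₁ x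

/-! ### The scalar formulation -/

/-- The scalar potential `φ = φ₀ + ∫ u dξ`. -/
def scalarPotential (φ₀ : ℝ → E3 → ℝ) (u : ℝ → E3 → E3 → ℝ) (t : ℝ) (x : E3) : ℝ :=
  φ₀ t x + ∫ ξ, u t x ξ

/-- The vector potential `A = ∫ v(ξ) u dξ`. -/
def vectorPotential (u : ℝ → E3 → E3 → ℝ) (t : ℝ) (x : E3) : E3 :=
  ∫ ξ, u t x ξ • velocity ξ

/-- The electric field `E = -∂ₜA - ∇φ` of an electromagnetic potential. -/
def electricField (T : ℝ) (φ : ℝ → E3 → ℝ) (A : ℝ → E3 → E3) (t : ℝ) (x : E3) : E3 :=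
  -timeDeriv T A t x - gradient (φ t) x

/-- The magnetic field `B = curl A` of an electromagnetic potential. -/
def magneticField (A : ℝ → E3 → E3) (t : ℝ) (x : E3) : E3 :=
  curl (A t) x

/-- `(f, u)` satisfies the scalar formulation of the Vlasov-Maxwell system on `[0, T]` with
initial data `f = fin`, `u = ∂ₜu = 0` at `t = 0`, where `φ₀` is the free part of the scalar
potential. For each momentum, `u` is a classical solution of the wave equation in the time and
position variables; no regularity of `u` in the momentum variable is required. -/
structure IsScalarSolution (T : ℝ) (fin : E3 → E3 → ℝ) (φ₀ : ℝ → E3 → ℝ)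
    (f u : ℝ → E3 → E3 → ℝ) : Prop where
  vlasov : VlasovEquation T f
    (electricField T (scalarPotential φ₀ u) (vectorPotential u))
    (magneticField (vectorPotential u))
  wave : ∀ ξ : E3, IsWaveSolution T (fun t x => f t x ξ) (fun _ => 0) (fun _ => 0)
    (fun t x => u t x ξ)
  initial : ∀ x ξ : E3, f 0 x ξ = fin x ξ

/-! ### The Vlasov-Maxwell system -/

/-- `(f, E, B)` is a classical solution of the Vlasov-Maxwell system on `[0, T]`. -/
structure IsVlasovMaxwellSolution (T : ℝ) (f : ℝ → E3 → E3 → ℝ) (E B : ℝ → E3 → E3) : Prop where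
  contDiffOn_f : ContDiffOn ℝ 1 (fun p : ℝ × E3 × E3 => f p.1 p.2.1 p.2.2) (phaseSlab T)
  contDiffOn_E : ContDiffOn ℝ 1 (fun p : ℝ × E3 => E p.1 p.2) (slab T)
  contDiffOn_B : ContDiffOn ℝ 1 (fun p : ℝ × E3 => B p.1 p.2) (slab T)
  vlasov : VlasovEquation T f E B
  div_B : ∀ t ∈ Icc 0 T, ∀ x : E3, divergence (B t) x = 0
  faraday : ∀ t ∈ Icc 0 T, ∀ x : E3, timeDeriv T B t x + curl (E t) x = 0
  gauss : ∀ t ∈ Icc 0 T, ∀ x : E3, divergence (E t) x = chargeDensity (f t) x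
  ampere : ∀ t ∈ Icc 0 T, ∀ x : E3,
    timeDeriv T E t x - curl (B t) x = -currentDensity (f t) x

/-- The initial condition `f = fin`, `E = -∇(-Δ)⁻¹ ∫ fin dξ`, `B = 0` at `t = 0`. -/
structure HasElectrostaticInitialData (fin : E3 → E3 → ℝ) (f : ℝ → E3 → E3 → ℝ)
    (E B : ℝ → E3 → E3) : Prop where
  initial_f : ∀ x ξ : E3, f 0 x ξ = fin x ξ
  initial_E : ∀ x : E3, E 0 x = -gradient (newtonPotential (chargeDensity fin)) x
  initial_B : ∀ x : E3, B 0 x = 0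

end VlasovMaxwell

end

open VlasovMaxwell

noncomputable section

open Filter Topology Metric

/-!
Everything rests on Kirchhoff's formula. For a classical solution `w` of `□w = h`, let `M s` be the
average of `w + (t - s) (∂ₜw + ∂ᵣw)` over the sphere of radius `t - s` about `x` at time `s`. By the
divergence theorem on the sphere, `M' s` is `t - s` times the average of `h` over that sphere, and
integrating from `0` to `t` writes `w t x` as a free wave determined by the data plus the retarded
potential of `h`. This yields uniqueness, and it makes `u` smooth in `(t, x, ξ)` although no
regularity in `ξ` is assumed; by uniqueness `u` vanishes for every `ξ` for which `f` does, so `φ`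
and `A` are smooth and may be differentiated under the integral sign.

The magnetic rotation and the electric translation in the momentum variable preserve volume, so
integrating the Vlasov equation in `ξ` gives `∂ₜρ + div j = 0`. Hence `∂ₜφ + div A` solves the
homogeneous wave equation. Its Cauchy data vanish, the time derivative at `t = 0` being
`ρ + Δφ^in = 0`. So the gauge condition holds, and Maxwell's equations follow algebraically from
`□φ = ρ` and `□A = j`. Poisson's equation for `φ^in` is itself a consequence of Kirchhoff's formula,
applied to a wave which does not depend on time.
-/

namespace VlasovMaxwell

section ParametricIntegral

variable {α P Q G : Type*} [NormedAddCommGroup P] [NormedAddCommGroup G] [NormedSpace ℝ G]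

section Compact

variable [TopologicalSpace α] [MeasurableSpace α] [OpensMeasurableSpace α] [T2Space α]
  {μ : Measure α} [IsFiniteMeasureOnCompacts μ] {A : Set α}

theorem continuousOn_setIntegral_of_isCompact {s : Set P} (hA : IsCompact A) {F : P → α → G}
    (hF : ContinuousOn (Function.uncurry F) (s ×ˢ A)) :
    ContinuousOn (fun p => ∫ a in A, F p a ∂μ) s := by
  intro p hp
  rw [ContinuousWithinAt, Metric.tendsto_nhds]
  intro ε hε
  obtain ⟨δ, hδ, hδε⟩ := exists_pos_mul_lt hε (μ.real A)
  obtain ⟨v, hv, hclose⟩ := hA.mem_uniformity_of_prod hF hp (dist_mem_uniformity hδ)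
  filter_upwards [hv, self_mem_nhdsWithin] with q hqv hqs
  rw [dist_eq_norm, ← integral_sub ((hF.uncurry_left q hqs).integrableOn_compact hA)
    ((hF.uncurry_left p hp).integrableOn_compact hA)]
  refine (norm_setIntegral_le_of_norm_le_const hA.measure_lt_top fun a ha => ?_).trans_lt
    ((mul_comm _ _).trans_lt hδε)
  exact (dist_eq_norm (F q a) (F p a)).symm.trans_le (hclose q hqv a ha).le

theorem hasFDerivWithinAt_setIntegral_of_isCompact [NormedSpace ℝ P] [CompleteSpace G] {s : Set P}
    (hs : Convex ℝ s) (hA : IsCompact A) {F : P → α → G} {F' : P → α → P →L[ℝ] G}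
    (hF : ∀ p ∈ s, ContinuousOn (F p) A)
    (hF' : ContinuousOn (Function.uncurry F') (s ×ˢ A))
    (hd : ∀ p ∈ s, ∀ a ∈ A, HasFDerivWithinAt (fun q => F q a) (F' p a) s p)
    {p : P} (hp : p ∈ s) :
    HasFDerivWithinAt (fun q => ∫ a in A, F q a ∂μ) (∫ a in A, F' p a ∂μ) s p := by
  have hint : ∀ q ∈ s, IntegrableOn (F q) A μ := fun q hq => (hF q hq).integrableOn_compact hA
  have hint' : IntegrableOn (F' p) A μ := (hF'.uncurry_left p hp).integrableOn_compact hA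
  refine .of_isLittleO (Asymptotics.isLittleO_iff.2 fun ε hε => ?_)
  obtain ⟨δ, hδ, hδε⟩ := exists_pos_mul_lt hε (μ.real A)
  obtain ⟨v, hv, hclose⟩ := hA.mem_uniformity_of_prod hF' hp (dist_mem_uniformity hδ)
  obtain ⟨r, hr, hrv⟩ := Metric.mem_nhdsWithin_iff.1 hv
  filter_upwards [inter_mem_nhdsWithin s (ball_mem_nhds p hr)] with q hq
  have hpw : ∀ a ∈ A, ‖F q a - F p a - F' p a (q - p)‖ ≤ δ * ‖q - p‖ := fun a ha =>
    (hs.inter (convex_ball p r)).norm_image_sub_le_of_norm_hasFDerivWithin_le'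
      (fun z hz => (hd z hz.1 a ha).mono inter_subset_left)
      (fun z hz => (dist_eq_norm _ _).symm.trans_le (hclose z (hrv ⟨hz.2, hz.1⟩) a ha).le)
      ⟨hp, mem_ball_self hr⟩ hq
  calc ‖(∫ a in A, F q a ∂μ) - (∫ a in A, F p a ∂μ) - (∫ a in A, F' p a ∂μ) (q - p)‖
      = ‖∫ a in A, (F q a - F p a - F' p a (q - p)) ∂μ‖ := by
        rw [ContinuousLinearMap.integral_apply hint',
          integral_sub ((hint q hq.1).sub' (hint p hp)) (hint'.apply_continuousLinearMap _),
          integral_sub (hint q hq.1) (hint p hp)]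
    _ ≤ δ * ‖q - p‖ * μ.real A :=
        norm_setIntegral_le_of_norm_le_const hA.measure_lt_top hpw
    _ ≤ ε * ‖q - p‖ := by nlinarith [norm_nonneg (q - p)]

theorem hasDerivAt_setIntegral_of_isCompact [CompleteSpace G] {s : Set ℝ} (hs : Convex ℝ s)
    (hA : IsCompact A) {F F' : ℝ → α → G} (hF : ∀ t ∈ s, ContinuousOn (F t) A)
    (hF' : ContinuousOn (Function.uncurry F') (s ×ˢ A))
    (hd : ∀ t ∈ s, ∀ a ∈ A, HasDerivAt (fun r => F r a) (F' t a) t) {t : ℝ} (ht : s ∈ 𝓝 t) :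
    HasDerivAt (fun r => ∫ a in A, F r a ∂μ) (∫ a in A, F' t a ∂μ) t := by
  let L : G →L[ℝ] ℝ →L[ℝ] G := ContinuousLinearMap.smulRightL ℝ ℝ G 1
  have hts : t ∈ s := mem_of_mem_nhds ht
  have key := hasFDerivWithinAt_setIntegral_of_isCompact (μ := μ) hs hA hF
    (F' := fun r a => L (F' r a)) (L.continuous.comp_continuousOn hF')
    (fun r hr a ha => (hd r hr a ha).hasFDerivAt.hasFDerivWithinAt) hts
  rw [ContinuousLinearMap.integral_comp_comm L
    ((hF'.uncurry_left t hts).integrableOn_compact hA)] at key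
  exact key.hasFDerivAt ht

end Compact

section Smooth

variable [NormedSpace ℝ P] [NormedAddCommGroup Q] [NormedSpace ℝ Q] {s : Set P} {S A : Set Q}

theorem hasFDerivWithinAt_prodMk_left {F : P × Q → G} {F' : P × Q →L[ℝ] G} {p : P} {a : Q}
    (h : HasFDerivWithinAt F F' (s ×ˢ S) (p, a)) (ha : a ∈ S) :
    HasFDerivWithinAt (fun q => F (q, a)) (F' ∘L .inl ℝ P Q) s p :=
  h.comp p (hasFDerivAt_prodMk_left p a).hasFDerivWithinAt
    (show MapsTo (·, a) s (s ×ˢ S) from fun _ hq => ⟨hq, ha⟩)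

variable [MeasurableSpace Q] [OpensMeasurableSpace Q] {μ : Measure Q}
  [IsFiniteMeasureOnCompacts μ]

theorem hasFDerivWithinAt_setIntegral_of_contDiffOn [CompleteSpace G] (hs : Convex ℝ s)
    (hs' : UniqueDiffOn ℝ s) (hS : UniqueDiffOn ℝ S) (hA : IsCompact A) (hAS : A ⊆ S)
    {F : P × Q → G} (hF : ContDiffOn ℝ 1 F (s ×ˢ S)) {p : P} (hp : p ∈ s) :
    HasFDerivWithinAt (fun q => ∫ a in A, F (q, a) ∂μ)
      (∫ a in A, fderivWithin ℝ F (s ×ˢ S) (p, a) ∘L .inl ℝ P Q ∂μ) s p := by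
  have hsub : s ×ˢ A ⊆ s ×ˢ S := prod_mono_right hAS
  refine hasFDerivWithinAt_setIntegral_of_isCompact hs hA (F := fun q a => F (q, a))
    (F' := fun q a => fderivWithin ℝ F (s ×ˢ S) (q, a) ∘L .inl ℝ P Q)
    (fun q hq => .uncurry_left (f := fun q a => F (q, a)) q hq (hF.continuousOn.mono hsub)) ?_ ?_ hp
  · exact ((hF.continuousOn_fderivWithin (hs'.prod hS) le_rfl).mono hsub).clm_comp
      continuousOn_const
  · exact fun q hq a ha => hasFDerivWithinAt_prodMk_left
      ((hF.differentiableOn one_ne_zero _ ⟨hq, hAS ha⟩).hasFDerivWithinAt) (hAS ha)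

theorem contDiffOn_setIntegral [CompleteSpace G] {n : ℕ∞} (hs : Convex ℝ s)
    (hs' : UniqueDiffOn ℝ s) (hS : UniqueDiffOn ℝ S) (hA : IsCompact A) (hAS : A ⊆ S)
    {F : P × Q → G} (hF : ContDiffOn ℝ n F (s ×ˢ S)) :
    ContDiffOn ℝ n (fun p => ∫ a in A, F (p, a) ∂μ) s := by
  set D := ftaylorSeriesWithin ℝ F (s ×ˢ S)
  have hT : HasFTaylorSeriesUpToOn n F D (s ×ˢ S) := hF.ftaylorSeriesWithin (hs'.prod hS)
  let L (m : ℕ) : (P × Q [×m]→L[ℝ] G) →L[ℝ] (P [×m]→L[ℝ] G) :=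
    ContinuousMultilinearMap.compContinuousLinearMapL fun _ => .inl ℝ P Q
  have hcont : ∀ m : ℕ, m ≤ (n : ℕ∞ω) →
      ContinuousOn (Function.uncurry fun p a => L m (D (p, a) m)) (s ×ˢ A) := fun m hm =>
    (L m).continuous.comp_continuousOn ((hT.cont m hm).mono (prod_mono_right hAS))
  refine HasFTaylorSeriesUpToOn.contDiffOn
    (f' := fun p m => ∫ a in A, L m (D (p, a) m) ∂μ) ⟨fun p hp => ?_, fun m hm p hp => ?_,
      fun m hm => continuousOn_setIntegral_of_isCompact hA (hcont m hm)⟩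
  · change (∫ a in A, L 0 (D (p, a) 0) ∂μ) 0 = _
    rw [ContinuousMultilinearMap.integral_apply
      (((hcont 0 zero_le).uncurry_left p hp).integrableOn_compact hA)]
    exact setIntegral_congr_fun hA.measurableSet fun a ha => hT.zero_eq (p, a) ⟨hp, hAS ha⟩
  · have hm' : ((m + 1 : ℕ) : ℕ∞ω) ≤ n := by
      exact_mod_cast Order.add_one_le_of_lt (show (m : ℕ∞) < n by exact_mod_cast hm)
    let curry : (P [×m + 1]→L[ℝ] G) →L[ℝ] P →L[ℝ] P [×m]→L[ℝ] G :=
      (continuousMultilinearCurryLeftEquiv ℝ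
        (fun _ : Fin (m + 1) => P) G).toContinuousLinearEquiv.toContinuousLinearMap
    have key := hasFDerivWithinAt_setIntegral_of_isCompact (μ := μ) hs hA
      (F := fun p a => L m (D (p, a) m)) (F' := fun p a => curry (L (m + 1) (D (p, a) (m + 1))))
      (fun q hq => (hcont m hm.le).uncurry_left q hq)
      (curry.continuous.comp_continuousOn (hcont (m + 1) hm'))
      (fun q hq a ha => ?_) hp
    · rwa [ContinuousLinearMap.integral_comp_comm (𝕜 := ℝ) (E := P [×m + 1]→L[ℝ] G)
        (Fₗ := P →L[ℝ] P [×m]→L[ℝ] G) curry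
        (((hcont (m + 1) hm').uncurry_left p hp).integrableOn_compact hA)] at key
    · refine ((L m).hasFDerivAt.comp_hasFDerivWithinAt q (hasFDerivWithinAt_prodMk_left
        (hT.fderivWithin m hm (q, a) ⟨hq, hAS ha⟩) (hAS ha))).congr_fderiv ?_
      ext v w
      simp only [ContinuousLinearMap.comp_apply]
      change D (q, a) (m + 1) (Fin.cons (v, 0) fun i => (w i, 0)) =
        D (q, a) (m + 1) fun i => ((Fin.cons v w : Fin (m + 1) → P) i, 0)
      exact congrArg _ (funext (Fin.cases rfl fun _ => rfl))

end Smooth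

end ParametricIntegral

section Rotation

variable {E : Type*} [NormedAddCommGroup E] [InnerProductSpace ℝ E] [FiniteDimensional ℝ E]
  [MeasurableSpace E] [BorelSpace E]

theorem setIntegral_closedBall_fderiv_skewAdjoint {μ : Measure E} [IsFiniteMeasureOnCompacts μ]
    (hμ : ∀ U : E ≃ₗᵢ[ℝ] E, MeasurePreserving U μ μ) {K : E →L[ℝ] E}
    (hK : K ∈ skewAdjoint (E →L[ℝ] E)) {g : E → ℝ} (hg : ContDiff ℝ 1 g) (R : ℝ) :
    ∫ x in closedBall 0 R, fderiv ℝ g x (K x) ∂μ = 0 := by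
  let flow (θ : ℝ) : E →L[ℝ] E := NormedSpace.exp (θ • K)
  let _ : NormedAlgebra ℚ (E →L[ℝ] E) := .restrictScalars ℚ ℝ _
  have hflow (θ : ℝ) : HasDerivAt flow (K * flow θ) θ := hasDerivAt_exp_smul_const' K θ
  have : Continuous flow := continuous_iff_continuousAt.2 fun θ => (hflow θ).continuousAt
  have hconst (θ : ℝ) :
      ∫ x in closedBall 0 R, g (flow θ x) ∂μ = ∫ x in closedBall 0 R, g x ∂μ := by
    let U : E ≃ₗᵢ[ℝ] E := Unitary.linearIsometryEquiv ⟨flow θ,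
      NormedSpace.exp_mem_unitary_of_mem_skewAdjoint (skewAdjoint.smul_mem θ hK)⟩
    have h := (hμ U).setIntegral_preimage_emb U.toHomeomorph.measurableEmbedding g (closedBall 0 R)
    rwa [U.preimage_closedBall, map_zero] at h
  have hderiv := hasDerivAt_setIntegral_of_isCompact (μ := μ) convex_univ
    (isCompact_closedBall (0 : E) R) (F := fun θ x => g (flow θ x))
    (F' := fun θ x => fderiv ℝ g (flow θ x) (K (flow θ x)))
    (fun θ _ => (hg.continuous.comp (flow θ).continuous).continuousOn)
    (Continuous.continuousOn (by
      have := hg.continuous_fderiv one_ne_zero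
      fun_prop))
    (fun θ _ x _ => ((hg.differentiable one_ne_zero _).hasFDerivAt.comp_hasDerivAt θ
      ((hflow θ).clm_apply (hasDerivAt_const θ x))).congr_deriv (by simp))
    (univ_mem (f := 𝓝 (0 : ℝ)))
  simp only [hconst] at hderiv
  simpa [flow] using hderiv.unique (hasDerivAt_const _ _)

end Rotation

section SphereMeasure

open scoped Pointwise

variable (E : Type*) [NormedAddCommGroup E] [InnerProductSpace ℝ E] [FiniteDimensional ℝ E]
  [MeasurableSpace E] [BorelSpace E]

/-- The uniform probability measure on the unit sphere, as a measure on the ambient space. -/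
def sphereMeasure : Measure E :=
  ((volume : Measure E).toSphere univ)⁻¹ • (volume : Measure E).toSphere.map (↑)

instance [Nontrivial E] : IsProbabilityMeasure (sphereMeasure E) where
  measure_univ := by
    rw [sphereMeasure, Measure.smul_apply, Measure.map_apply measurable_subtype_coe .univ,
      preimage_univ, smul_eq_mul, ENNReal.inv_mul_cancel _ (measure_ne_top _ _)]
    exact Measure.measure_univ_ne_zero.2 (Measure.toSphere_ne_zero _)

theorem ae_sphereMeasure_norm_eq_one : ∀ᵐ z ∂sphereMeasure E, ‖z‖ = 1 :=
  Measure.ae_smul_measure ((ae_map_iff measurable_subtype_coe.aemeasurable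
    (measurableSet_eq_fun (by fun_prop) (by fun_prop))).2
      (.of_forall fun z => mem_sphere_zero_iff_norm.1 z.2)) _

theorem restrict_closedBall_sphereMeasure :
    (sphereMeasure E).restrict (closedBall 0 1) = sphereMeasure E :=
  Measure.restrict_eq_self_of_ae_mem <| (ae_sphereMeasure_norm_eq_one E).mono fun z hz => by
    simp [hz]

variable {E}

theorem measurePreserving_sphereMeasure (U : E ≃ₗᵢ[ℝ] E) :
    MeasurePreserving U (sphereMeasure E) (sphereMeasure E) := by
  have hcone (B : Set E) : Ioo (0 : ℝ) 1 • (sphere 0 1 ∩ U ⁻¹' B) =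
      U ⁻¹' (Ioo (0 : ℝ) 1 • (sphere 0 1 ∩ B)) := by
    ext x
    simp only [Set.mem_smul, mem_inter_iff, mem_sphere_zero_iff_norm, mem_preimage]
    refine ⟨fun ⟨r, hr, y, hy, hx⟩ => ⟨r, hr, U y, by simpa using hy, by rw [← hx, map_smul]⟩,
      fun ⟨r, hr, y, hy, hx⟩ => ⟨r, hr, U.symm y, by simpa using hy, ?_⟩⟩
    exact U.injective (by rw [map_smul, U.apply_symm_apply, hx])
  refine ⟨U.continuous.measurable, Measure.ext fun B hB => ?_⟩
  have hUB : MeasurableSet (U ⁻¹' B) := U.continuous.measurable hB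
  rw [Measure.map_apply U.continuous.measurable hB, sphereMeasure, Measure.smul_apply,
    Measure.smul_apply, Measure.map_apply measurable_subtype_coe hUB,
    Measure.map_apply measurable_subtype_coe hB,
    Measure.toSphere_apply' _ (measurable_subtype_coe hUB),
    Measure.toSphere_apply' _ (measurable_subtype_coe hB), Subtype.image_preimage_coe,
    Subtype.image_preimage_coe, hcone,
    U.measurePreserving.measure_preimage_emb U.toHomeomorph.measurableEmbedding]

theorem integrable_sphereMeasure [Nontrivial E] {G : Type*} [NormedAddCommGroup G] {g : E → G}
    (hg : ContinuousOn g (closedBall 0 1)) : Integrable g (sphereMeasure E) := by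
  simpa only [IntegrableOn, restrict_closedBall_sphereMeasure] using
    hg.integrableOn_compact (μ := sphereMeasure E) (isCompact_closedBall _ _)

theorem integral_toSphere_eq_smul_integral_sphereMeasure [Nontrivial E] {G : Type*}
    [NormedAddCommGroup G] [NormedSpace ℝ G] (g : E → G) :
    ∫ z : sphere (0 : E) 1, g z ∂(volume : Measure E).toSphere =
      (volume : Measure E).toSphere.real univ • ∫ z, g z ∂sphereMeasure E := by
  have hne : (volume : Measure E).toSphere.real univ ≠ 0 :=
    (measureReal_ne_zero_iff (measure_ne_top _ _)).2
      (Measure.measure_univ_ne_zero.2 (Measure.toSphere_ne_zero _))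
  rw [sphereMeasure, integral_smul_measure, (MeasurableEmbedding.subtype_coe
    isClosed_sphere.measurableSet).integral_map, ENNReal.toReal_inv, ← measureReal_def,
    smul_inv_smul₀ hne]

theorem integral_eq_smul_integral_Ioi_sphereMeasure [Nontrivial E] {G : Type*}
    [NormedAddCommGroup G] [NormedSpace ℝ G] {g : E → G} (hg : Integrable g) :
    ∫ x, g x = (volume : Measure E).toSphere.real univ •
      ∫ r in Ioi (0 : ℝ), r ^ (Module.finrank ℝ E - 1) • ∫ z, g (r • z) ∂sphereMeasure E := by
  let polar (q : sphere (0 : E) 1 × Ioi (0 : ℝ)) : G := g (q.2.1 • q.1.1)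
  have hpolar : polar ∘ homeomorphUnitSphereProd E = fun x : ({0}ᶜ : Set E) => g x := by
    ext x
    exact congrArg g (congrArg Subtype.val ((homeomorphUnitSphereProd E).symm_apply_apply x))
  have hpres := (volume : Measure E).measurePreserving_homeomorphUnitSphereProd
  have hemb := (homeomorphUnitSphereProd E).measurableEmbedding
  have hpolar_int : Integrable polar ((volume : Measure E).toSphere.prod
      (.volumeIoiPow (Module.finrank ℝ E - 1))) := by
    rw [← hpres.integrable_comp_emb hemb, hpolar]
    exact (integrableOn_iff_comap_subtypeVal (measurableSet_singleton _).compl).1 hg.integrableOn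
  calc ∫ x, g x = ∫ x : ({0}ᶜ : Set E), g x ∂((volume : Measure E).comap (↑)) := by
        rw [integral_subtype_comap (measurableSet_singleton _).compl g, restrict_compl_singleton]
    _ = ∫ r, ∫ z, polar (z, r) ∂(volume : Measure E).toSphere
          ∂.volumeIoiPow (Module.finrank ℝ E - 1) := by
        rw [← integral_prod_symm _ hpolar_int, ← hpres.integral_comp hemb]
        exact congrArg (integral _) hpolar.symm
    _ = _ := by
        have hinner (r : ℝ) := integral_toSphere_eq_smul_integral_sphereMeasure (g <| r • ·)
        simp only [polar, hinner, integral_smul]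
        simp only [Measure.volumeIoiPow, ENNReal.ofReal]
        rw [integral_withDensity_eq_integral_smul (by fun_prop),
          integral_subtype_comap measurableSet_Ioi fun r : ℝ => Real.toNNReal (r ^ _) •
            ∫ z, g (r • z) ∂sphereMeasure E]
        congr 1
        refine setIntegral_congr_fun measurableSet_Ioi fun r hr => ?_
        simp only [NNReal.smul_def, Real.coe_toNNReal _ (pow_nonneg (le_of_lt hr) _)]

end SphereMeasure

section SphereDivergence

open scoped RealInnerProductSpace

variable {E : Type*} [NormedAddCommGroup E] [InnerProductSpace ℝ E] [FiniteDimensional ℝ E]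

theorem innerSL_smulRight_sub_mem_skewAdjoint (v e : E) :
    (innerSL ℝ e).smulRight v - (innerSL ℝ v).smulRight e ∈ skewAdjoint (E →L[ℝ] E) := by
  rw [skewAdjoint.mem_iff, ContinuousLinearMap.star_eq_adjoint, eq_comm,
    ContinuousLinearMap.eq_adjoint_iff]
  intro x y
  simp [inner_sub_left, inner_sub_right, real_inner_smul_right, real_inner_comm,
    mul_comm]

variable [MeasurableSpace E] [BorelSpace E]

theorem integral_sphereMeasure_fderiv_tangential [Nontrivial E] {g : E → ℝ} (hg : ContDiff ℝ 1 g)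
    (v : E) :
    ∫ z, (fderiv ℝ g z v - ⟪z, v⟫ * fderiv ℝ g z z) ∂sphereMeasure E =
      (Module.finrank ℝ E - 1) * ∫ z, ⟪z, v⟫ * g z ∂sphereMeasure E := by
  -- `⟪b i, z⟫ v - ⟪v, z⟫ b i` generates a rotation, and these fields with weights `⟪z, b i⟫` add up
  -- to the tangential part `v - ⟪z, v⟫ z` of `v`.
  let b := stdOrthonormalBasis ℝ E
  let D (i) (z : E) : ℝ := fderiv ℝ (fun x => ⟪x, b i⟫ * g x) z (⟪b i, z⟫ • v - ⟪v, z⟫ • b i)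
  have hprod (i) : ContDiff ℝ 1 fun x => ⟪x, b i⟫ * g x :=
    (contDiff_id.inner ℝ contDiff_const).mul hg
  have := hg.continuous_fderiv one_ne_zero
  have hzero (i) : ∫ z, D i z ∂sphereMeasure E = 0 := by
    rw [← restrict_closedBall_sphereMeasure E]
    exact setIntegral_closedBall_fderiv_skewAdjoint measurePreserving_sphereMeasure
      (innerSL_smulRight_sub_mem_skewAdjoint v (b i)) (hprod i) 1
  have hD (i) (z : E) : D i z = (⟪z, b i⟫ * ⟪b i, v⟫ - ⟪z, v⟫) * g z +
      (⟪z, b i⟫ * ⟪b i, z⟫ * fderiv ℝ g z v - ⟪z, v⟫ * fderiv ℝ g z (⟪b i, z⟫ • b i)) := by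
    have hfd := ((innerSL ℝ (b i)).hasFDerivAt (x := z)).mul
      (hg.differentiable one_ne_zero z).hasFDerivAt
    have hfd' : HasFDerivAt (fun x => ⟪x, b i⟫ * g x) _ z :=
      hfd.congr_of_eventuallyEq (.of_forall fun x => by simp [real_inner_comm])
    simp only [D, hfd'.fderiv]
    simp [inner_sub_right, real_inner_smul_right, real_inner_comm]
    ring
  have hsum (z : E) (hz : ‖z‖ = 1) : ∑ i, D i z =
      (fderiv ℝ g z v - ⟪z, v⟫ * fderiv ℝ g z z) - (Module.finrank ℝ E - 1) * (⟪z, v⟫ * g z) := by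
    simp only [hD, Finset.sum_add_distrib, Finset.sum_sub_distrib, ← Finset.sum_mul,
      ← Finset.mul_sum, ← map_sum, b.sum_inner_mul_inner, b.sum_repr', real_inner_self_eq_norm_sq,
      hz]
    simp
    ring
  have hint {h : E → ℝ} (hh : Continuous h) : Integrable h (sphereMeasure E) :=
    integrable_sphereMeasure hh.continuousOn
  rw [← sub_eq_zero, ← integral_const_mul, ← integral_sub (hint (by fun_prop)) (hint (by fun_prop)),
    ← integral_congr_ae ((ae_sphereMeasure_norm_eq_one E).mono hsum),
    integral_finsetSum _ fun i _ => hint ((funext (hD i)).symm ▸ by fun_prop)]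
  exact Finset.sum_eq_zero fun i _ => hzero i

theorem integral_sphereMeasure_laplacian_sub [Nontrivial E] {q : E → ℝ} (hq : ContDiff ℝ 2 q)
    (x : E) (r : ℝ) :
    ∫ z, r * (Laplacian.laplacian q (x + r • z) - fderiv ℝ (fderiv ℝ q) (x + r • z) z z)
        ∂sphereMeasure E =
      (Module.finrank ℝ E - 1) * ∫ z, fderiv ℝ q (x + r • z) z ∂sphereMeasure E := by
  let b := stdOrthonormalBasis ℝ E
  have hq' : ContDiff ℝ 1 (fderiv ℝ q) := hq.fderiv_right le_rfl
  have := hq'.continuous_fderiv one_ne_zero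
  have hq'_cont := hq'.continuous
  let h (i) (z : E) : ℝ := fderiv ℝ q (x + r • z) (b i)
  have hh (i) : ContDiff ℝ 1 (h i) := by fun_prop
  have hfd (i) (z w : E) : fderiv ℝ (h i) z w = r * fderiv ℝ (fderiv ℝ q) (x + r • z) w (b i) := by
    have haff : HasFDerivAt (fun z : E => x + r • z) (r • .id ℝ E) z :=
      ((hasFDerivAt_id z).const_smul r).const_add x
    have := ((hq'.differentiable one_ne_zero _).hasFDerivAt.comp z haff).clm_apply
      (hasFDerivAt_const (b i) z)
    rw [(show HasFDerivAt (h i) _ z from this).fderiv]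
    simp
  have hint {k : E → ℝ} (hk : Continuous k) : Integrable k (sphereMeasure E) :=
    integrable_sphereMeasure hk.continuousOn
  have hlap (z : E) :
      r * (Laplacian.laplacian q (x + r • z) - fderiv ℝ (fderiv ℝ q) (x + r • z) z z) =
        ∑ i, (fderiv ℝ (h i) z (b i) - ⟪z, b i⟫ * fderiv ℝ (h i) z z) := by
    simp only [InnerProductSpace.laplacian_eq_iteratedFDeriv_orthonormalBasis q b, hfd,
      iteratedFDeriv_two_apply, Matrix.cons_val_zero, Matrix.cons_val_one,
      Finset.sum_sub_distrib, ← Finset.mul_sum]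
    have hz : fderiv ℝ (fderiv ℝ q) (x + r • z) z z =
        ∑ i, ⟪z, b i⟫ * fderiv ℝ (fderiv ℝ q) (x + r • z) z (b i) := by
      conv_lhs => enter [2]; rw [← b.sum_repr' z]
      simp [real_inner_comm]
    simp only [mul_left_comm _ r, ← Finset.mul_sum, hz, mul_sub]
  have hgrad (z : E) : fderiv ℝ q (x + r • z) z = ∑ i, ⟪z, b i⟫ * h i z := by
    conv_lhs => enter [2]; rw [← b.sum_repr' z]
    simp [h, real_inner_comm]
  simp only [hlap, hgrad]
  rw [integral_finsetSum _ fun i _ => hint (by fun_prop),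
    integral_finsetSum _ fun i _ => hint (by fun_prop), Finset.mul_sum]
  exact Finset.sum_congr rfl fun i _ => integral_sphereMeasure_fderiv_tangential (hh i) (b i)

end SphereDivergence

section Slab

variable {F : Type*} [NormedAddCommGroup F] [NormedSpace ℝ F] {T t : ℝ} {x : E3}

theorem uniqueDiffOn_slab (hT : 0 < T) : UniqueDiffOn ℝ (slab T) :=
  (uniqueDiffOn_Icc hT).prod uniqueDiffOn_univ

theorem convex_slab : Convex ℝ (slab T) :=
  (convex_Icc 0 T).prod convex_univ

theorem mk_mem_slab (ht : t ∈ Icc 0 T) : (t, x) ∈ slab T :=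
  ⟨ht, mem_univ x⟩

theorem slab_mem_nhds (ht : t ∈ Ioo 0 T) : slab T ∈ 𝓝 (t, x) :=
  prod_mem_nhds (Icc_mem_nhds ht.1 ht.2) univ_mem

theorem timeDeriv_eq_fderivWithin_slab {w : ℝ → E3 → F} (hT : 0 < T) (ht : t ∈ Icc 0 T)
    (hw : DifferentiableWithinAt ℝ (Function.uncurry w) (slab T) (t, x)) :
    timeDeriv T w t x = fderivWithin ℝ (Function.uncurry w) (slab T) (t, x) (1, 0) := by
  refine HasDerivWithinAt.derivWithin ?_ (uniqueDiffOn_Icc hT t ht)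
  refine hw.hasFDerivWithinAt.comp_hasDerivWithinAt t
    ((hasDerivWithinAt_id t _).prodMk (hasDerivWithinAt_const t _ x)) fun s hs => mk_mem_slab hs

theorem hasFDerivAt_of_differentiableWithinAt_slab {w : ℝ → E3 → F} (ht : t ∈ Icc 0 T)
    (hw : DifferentiableWithinAt ℝ (Function.uncurry w) (slab T) (t, x)) :
    HasFDerivAt (w t)
      (fderivWithin ℝ (Function.uncurry w) (slab T) (t, x) ∘L .inr ℝ ℝ E3) x :=
  hasFDerivWithinAt_univ.1 <| hw.hasFDerivWithinAt.comp x
    (hasFDerivAt_prodMk_right t x).hasFDerivWithinAt fun _ _ => mk_mem_slab ht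

end Slab

section Kirchhoff

/-- Kirchhoff's formula for the solution of the homogeneous wave equation on `ℝ × ℝ³` with data
`w₀`, `w₁`; the derivative of the spherical mean of `w₀` is taken under the integral sign. -/
def freeWave (w₀ w₁ : E3 → ℝ) (t : ℝ) (x : E3) : ℝ :=
  ∫ z, (w₀ (x + t • z) + t * (w₁ (x + t • z) + fderiv ℝ w₀ (x + t • z) z)) ∂sphereMeasure E3

/-- The retarded potential of a source `h` on `ℝ × ℝ³`: the solution of `□w = h` with zero initial
data, given by Duhamel's principle. -/
def retardedPotential (h : ℝ → E3 → ℝ) (t : ℝ) (x : E3) : ℝ :=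
  ∫ s in (0 : ℝ)..t, (t - s) * ∫ z, h s (x + (t - s) • z) ∂sphereMeasure E3

theorem hasDerivAt_backwardCone {E : Type*} [NormedAddCommGroup E] [NormedSpace ℝ E]
    {W : ℝ × E → ℝ} {D : ℝ × E → ℝ × E →L[ℝ] ℝ} {D' : ℝ × E →L[ℝ] ℝ × E →L[ℝ] ℝ} {x z : E}
    {t s : ℝ} (hW : HasFDerivAt W (D (s, x + (t - s) • z)) (s, x + (t - s) • z))
    (hD : HasFDerivAt D D' (s, x + (t - s) • z)) (hsymm : ∀ a b, D' a b = D' b a) :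
    HasDerivAt
      (fun r => W (r, x + (t - r) • z) + (t - r) * D (r, x + (t - r) • z) (1, z))
      ((t - s) * (D' (1, 0) (1, 0) - D' (0, z) (0, z)) - 2 * D (s, x + (t - s) • z) (0, z)) s := by
  have hcone : HasDerivAt (fun r => (r, x + (t - r) • z)) ((1 : ℝ), -z) s := by
    simpa using (hasDerivAt_id s).prodMk
      ((((hasDerivAt_id s).const_sub t).smul_const z).const_add x)
  have hlin : HasDerivAt (fun r => t - r) (-1) s := by simpa using (hasDerivAt_id s).const_sub t
  have hD_cone : HasDerivAt (fun r => D (r, x + (t - r) • z) (1, z)) (D' (1, -z) (1, z)) s :=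
    ((ContinuousLinearMap.apply ℝ ℝ ((1 : ℝ), z)).hasFDerivAt.comp_hasDerivAt s
      (hD.comp_hasDerivAt s hcone))
  refine ((hW.comp_hasDerivAt s hcone).add (hlin.mul hD_cone)).congr_deriv ?_
  have h₁ : ((1 : ℝ), z) = (1, 0) + (0, z) := by simp
  have h₂ : ((1 : ℝ), -z) = (1, 0) - (0, z) := by simp
  simp only [h₁, h₂, map_add, map_sub, sub_apply, hsymm (0, z) (1, 0)]
  ring

variable {T t : ℝ} {h w : ℝ → E3 → ℝ} {w₀ w₁ : E3 → ℝ}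

theorem dAlembert_eq_fderiv_fderiv (hT : 0 < T)
    (hw : ContDiffOn ℝ 2 (Function.uncurry w) (Ioo 0 T ×ˢ univ)) (ht : t ∈ Ioo 0 T) (x : E3) :
    dAlembert T w t x = fderiv ℝ (fderiv ℝ (Function.uncurry w)) (t, x) (1, 0) (1, 0) -
      Laplacian.laplacian (w t) x := by
  have hw' {s : ℝ} (hs : s ∈ Ioo 0 T) : ContDiffAt ℝ 2 (Function.uncurry w) (s, x) :=
    hw.contDiffAt (prod_mem_nhds (isOpen_Ioo.mem_nhds hs) univ_mem)
  have htime : ∀ᶠ s in 𝓝 t, timeDeriv T w s x = fderiv ℝ (Function.uncurry w) (s, x) (1, 0) := by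
    filter_upwards [isOpen_Ioo.mem_nhds ht] with s hs
    rw [timeDeriv_eq_fderivWithin_slab hT (Ioo_subset_Icc_self hs)
      ((hw' hs).differentiableAt two_ne_zero).differentiableWithinAt,
      fderivWithin_of_mem_nhds (slab_mem_nhds hs)]
  have hderiv : HasDerivAt (fun s => fderiv ℝ (Function.uncurry w) (s, x) (1, 0))
      (fderiv ℝ (fderiv ℝ (Function.uncurry w)) (t, x) (1, 0) (1, 0)) t := by
    have hD := (((hw' ht).fderiv_right (m := 1) le_rfl).differentiableAt one_ne_zero).hasFDerivAt
    exact (ContinuousLinearMap.apply ℝ ℝ ((1 : ℝ), (0 : E3))).hasFDerivAt.comp_hasDerivAt t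
      (hD.comp_hasDerivAt t ((hasDerivAt_id t).prodMk (hasDerivAt_const t x)))
  rw [dAlembert, timeDeriv, derivWithin_of_mem_nhds (Icc_mem_nhds ht.1 ht.2),
    EventuallyEq.deriv_eq htime, hderiv.deriv]

theorem fderiv_fderiv_slice {E : Type*} [NormedAddCommGroup E] [NormedSpace ℝ E] {W : ℝ × E → ℝ}
    {t : ℝ} (hW : ∀ y, ContDiffAt ℝ 2 W (t, y)) (y v v' : E) :
    fderiv ℝ (fderiv ℝ fun y => W (t, y)) y v v' =
      fderiv ℝ (fderiv ℝ W) (t, y) (0, v) (0, v') := by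
  let R : (ℝ × E →L[ℝ] ℝ) →L[ℝ] E →L[ℝ] ℝ :=
    (ContinuousLinearMap.compL ℝ E (ℝ × E) ℝ).flip (.inr ℝ ℝ E)
  have hfirst : (fderiv ℝ fun y => W (t, y)) = fun y => R (fderiv ℝ W (t, y)) := funext fun y =>
    (((hW y).differentiableAt two_ne_zero).hasFDerivAt.comp y (hasFDerivAt_prodMk_right t y)).fderiv
  have hsecond := ((hW y).fderiv_right (m := 1) le_rfl).differentiableAt one_ne_zero
  have hslice : HasFDerivAt (fun y => R (fderiv ℝ W (t, y))) _ y :=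
    R.hasFDerivAt.comp y (hsecond.hasFDerivAt.comp y (hasFDerivAt_prodMk_right t y))
  rw [hfirst, hslice.fderiv]
  rfl

/-- The average over the sphere of radius `t - s` of `w + (t - s) (∂ₜw + ∂ᵣw)`: Kirchhoff's formula
started at time `s`. -/
def coneMean (T : ℝ) (w : ℝ → E3 → ℝ) (t : ℝ) (x : E3) (s : ℝ) : ℝ :=
  ∫ z in closedBall 0 1, (w s (x + (t - s) • z) + (t - s) *
    fderivWithin ℝ (Function.uncurry w) (slab T) (s, x + (t - s) • z) (1, z)) ∂sphereMeasure E3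

theorem continuous_laplacian {E : Type*} [NormedAddCommGroup E] [InnerProductSpace ℝ E]
    [FiniteDimensional ℝ E] {q : E → ℝ} (hq : ContDiff ℝ 2 q) :
    Continuous (Laplacian.laplacian q) := by
  rw [InnerProductSpace.laplacian_eq_iteratedFDeriv_stdOrthonormalBasis]
  have := hq.continuous_iteratedFDeriv (m := 2) le_rfl
  fun_prop

theorem integral_backwardCone_eq_dAlembert (hT : 0 < T)
    (hw : ContDiffOn ℝ 2 (Function.uncurry w) (Ioo 0 T ×ˢ univ)) {s : ℝ} (hs : s ∈ Ioo 0 T)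
    (t : ℝ) (x : E3) :
    ∫ z, ((t - s) *
        (fderiv ℝ (fderiv ℝ (Function.uncurry w)) (s, x + (t - s) • z) (1, 0) (1, 0) -
          fderiv ℝ (fderiv ℝ (Function.uncurry w)) (s, x + (t - s) • z) (0, z) (0, z)) -
        2 * fderiv ℝ (Function.uncurry w) (s, x + (t - s) • z) (0, z)) ∂sphereMeasure E3 =
      (t - s) * ∫ z, dAlembert T w s (x + (t - s) • z) ∂sphereMeasure E3 := by
  set W := Function.uncurry w
  have hW (y : E3) : ContDiffAt ℝ 2 W (s, y) :=
    hw.contDiffAt (prod_mem_nhds (isOpen_Ioo.mem_nhds hs) univ_mem)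
  have hq : ContDiff ℝ 2 (w s) := contDiff_iff_contDiffAt.2 fun y =>
    (hW y).comp y (contDiffAt_const.prodMk contDiffAt_id)
  have hq₁ (y v : E3) : fderiv ℝ W (s, y) (0, v) = fderiv ℝ (w s) y v := by
    have := ((hW y).differentiableAt two_ne_zero).hasFDerivAt.comp y (hasFDerivAt_prodMk_right s y)
    exact (DFunLike.congr_fun this.fderiv v).symm
  have hq₂ (y v : E3) : fderiv ℝ (fderiv ℝ W) (s, y) (0, v) (0, v) =
      fderiv ℝ (fderiv ℝ (w s)) y v v := (fderiv_fderiv_slice (W := W) hW y v v).symm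
  have hint {k : E3 → ℝ} (hk : Continuous k) : Integrable k (sphereMeasure E3) :=
    integrable_sphereMeasure hk.continuousOn
  let Dtt (y : E3) : ℝ := fderiv ℝ (fderiv ℝ W) (s, y) (1, 0) (1, 0)
  have hDtt (y : E3) : fderiv ℝ (fderiv ℝ W) (s, y) (1, 0) (1, 0) = Dtt y := rfl
  have hDtt_cont : Continuous Dtt := continuous_iff_continuousAt.2 fun y => by
    have := ((((hW y).fderiv_right (m := 1) le_rfl).fderiv_right (m := 0) le_rfl).continuousAt).comp
      (Continuous.prodMk_right s).continuousAt
    exact (this.clm_apply continuousAt_const).clm_apply continuousAt_const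
  have hwave (y : E3) : dAlembert T w s y = Dtt y - Laplacian.laplacian (w s) y :=
    dAlembert_eq_fderiv_fderiv hT hw hs y
  have hlap := continuous_laplacian hq
  have hq' : ContDiff ℝ 1 (fderiv ℝ (w s)) := hq.fderiv_right le_rfl
  have hq'_cont := hq'.continuous
  have := hq'.continuous_fderiv one_ne_zero
  have hdarboux := integral_sphereMeasure_laplacian_sub hq x (t - s)
  simp only [finrank_euclideanSpace_fin, hq₁, hq₂, hDtt, hwave] at hdarboux ⊢
  norm_num at hdarboux
  rw [← integral_const_mul, ← sub_eq_zero, ← integral_sub (hint (by fun_prop)) (hint (by fun_prop)),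
    ← sub_eq_zero.2 hdarboux, ← integral_const_mul,
    ← integral_sub (hint (by fun_prop)) (hint (by fun_prop))]
  congr 1 with z
  ring

theorem hasDerivAt_backwardCone_slab
    (hw : ContDiffOn ℝ 2 (Function.uncurry w) (Ioo 0 T ×ˢ univ)) {s : ℝ} (hs : s ∈ Ioo 0 T)
    (t : ℝ) (x z : E3) :
    HasDerivAt (fun r => Function.uncurry w (r, x + (t - r) • z) + (t - r) *
        fderivWithin ℝ (Function.uncurry w) (slab T) (r, x + (t - r) • z) (1, z))
      ((t - s) *
        (fderiv ℝ (fderiv ℝ (Function.uncurry w)) (s, x + (t - s) • z) (1, 0) (1, 0) -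
          fderiv ℝ (fderiv ℝ (Function.uncurry w)) (s, x + (t - s) • z) (0, z) (0, z)) -
        2 * fderiv ℝ (Function.uncurry w) (s, x + (t - s) • z) (0, z)) s := by
  set W := Function.uncurry w
  have hO : Ioo 0 T ×ˢ univ ∈ 𝓝 (s, x + (t - s) • z) :=
    prod_mem_nhds (isOpen_Ioo.mem_nhds hs) univ_mem
  have hW : ContDiffAt ℝ 2 W (s, x + (t - s) • z) := hw.contDiffAt hO
  have hD : fderivWithin ℝ W (slab T) =ᶠ[𝓝 (s, x + (t - s) • z)] fderiv ℝ W := by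
    filter_upwards [hO] with p hp using fderivWithin_of_mem_nhds (slab_mem_nhds hp.1)
  rw [← hD.eq_of_nhds]
  refine hasDerivAt_backwardCone ?_ (HasFDerivAt.congr_of_eventuallyEq ?_ hD)
    (hW.isSymmSndFDerivAt (by simp)).eq
  · rw [hD.eq_of_nhds]
    exact (hW.differentiableAt two_ne_zero).hasFDerivAt
  · exact ((hW.fderiv_right (m := 1) le_rfl).differentiableAt one_ne_zero).hasFDerivAt

theorem continuousOn_backwardCone (ht : t ≤ T) (x : E3) :
    ContinuousOn (fun p : ℝ × E3 => (p.1, x + (t - p.1) • p.2)) (Icc 0 t ×ˢ closedBall 0 1) ∧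
      MapsTo (fun p : ℝ × E3 => (p.1, x + (t - p.1) • p.2)) (Icc 0 t ×ˢ closedBall 0 1) (slab T) :=
  ⟨by fun_prop, fun _ hp => mk_mem_slab (Icc_subset_Icc_right ht hp.1)⟩

theorem IsWaveSolution.continuousOn_coneIntegrand (hw : IsWaveSolution T h w₀ w₁ w) (hT : 0 < T)
    (ht : t ≤ T) (x : E3) :
    ContinuousOn (Function.uncurry fun s (z : E3) => w s (x + (t - s) • z) + (t - s) *
      fderivWithin ℝ (Function.uncurry w) (slab T) (s, x + (t - s) • z) (1, z))
      (Icc 0 t ×ˢ closedBall 0 1) := by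
  obtain ⟨hcone, hmaps⟩ := continuousOn_backwardCone ht x
  exact (hw.contDiffOn_one.continuousOn.comp hcone hmaps).add
    (ContinuousOn.mul (by fun_prop) (ContinuousOn.clm_apply
      ((hw.contDiffOn_one.continuousOn_fderivWithin (uniqueDiffOn_slab hT) le_rfl).comp
        hcone hmaps) (by fun_prop)))

theorem IsWaveSolution.hasDerivAt_coneMean (hw : IsWaveSolution T h w₀ w₁ w) (hT : 0 < T)
    (ht : t ≤ T) (x : E3) {s : ℝ} (hs : s ∈ Ioo 0 t) :
    HasDerivAt (coneMean T w t x)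
      ((t - s) * ∫ z, h s (x + (t - s) • z) ∂sphereMeasure E3) s := by
  have hsub : Ioo 0 t ⊆ Ioo 0 T := Ioo_subset_Ioo_right ht
  have hopen : IsOpen (Ioo 0 T ×ˢ univ : Set (ℝ × E3)) := isOpen_Ioo.prod isOpen_univ
  have hcone : ContinuousOn (fun p : ℝ × E3 => (p.1, x + (t - p.1) • p.2))
    (Ioo 0 t ×ˢ closedBall 0 1) := by fun_prop
  have hmaps : MapsTo (fun p : ℝ × E3 => (p.1, x + (t - p.1) • p.2))
    (Ioo 0 t ×ˢ closedBall 0 1) (Ioo 0 T ×ˢ univ) := fun p hp => ⟨hsub hp.1, mem_univ _⟩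
  have hD₁ := hw.contDiffOn_two.fderiv_of_isOpen (m := 1) hopen le_rfl
  have hD₁_cone := hD₁.continuousOn.comp hcone hmaps
  have hD₂_cone := (hD₁.fderiv_of_isOpen (m := 0) hopen le_rfl).continuousOn.comp hcone hmaps
  have key := hasDerivAt_setIntegral_of_isCompact (μ := sphereMeasure E3) (convex_Ioo 0 t)
    (isCompact_closedBall (0 : E3) 1)
    (fun r hr => (hw.continuousOn_coneIntegrand hT ht x).uncurry_left r (Ioo_subset_Icc_self hr)) ?_
    (fun r hr z _ => hasDerivAt_backwardCone_slab hw.contDiffOn_two (hsub hr) t x z)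
    (isOpen_Ioo.mem_nhds hs)
  · refine key.congr_deriv ?_
    rw [restrict_closedBall_sphereMeasure,
      integral_backwardCone_eq_dAlembert hT hw.contDiffOn_two (hsub hs)]
    simp only [hw.equation s (hsub hs)]
  · exact (ContinuousOn.mul (by fun_prop) (ContinuousOn.sub
        ((hD₂_cone.clm_apply continuousOn_const).clm_apply continuousOn_const)
        ((hD₂_cone.clm_apply (by fun_prop)).clm_apply (by fun_prop)))).sub
      (continuousOn_const.mul (hD₁_cone.clm_apply (by fun_prop)))

theorem IsWaveSolution.eq_freeWave_add_retardedPotential (hw : IsWaveSolution T h w₀ w₁ w)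
    (hh : ContinuousOn (Function.uncurry h) (slab T)) (hT : 0 < T) (ht : t ∈ Icc 0 T) (x : E3) :
    w t x = freeWave w₀ w₁ t x + retardedPotential h t x := by
  have hw_diff (y : E3) : DifferentiableWithinAt ℝ (Function.uncurry w) (slab T) (0, y) :=
    hw.contDiffOn_one.differentiableOn one_ne_zero _ (mk_mem_slab (left_mem_Icc.2 hT.le))
  have hstart : coneMean T w t x 0 = freeWave w₀ w₁ t x := by
    have hw₀ : w 0 = w₀ := funext hw.initial
    have hgrad (y z : E3) : fderivWithin ℝ (Function.uncurry w) (slab T) (0, y) (1, z) =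
        w₁ y + fderiv ℝ w₀ y z := by
      rw [← hw.initial_timeDeriv y, ← hw₀, timeDeriv_eq_fderivWithin_slab hT
        (left_mem_Icc.2 hT.le) (hw_diff y), (hasFDerivAt_of_differentiableWithinAt_slab
        (left_mem_Icc.2 hT.le) (hw_diff y)).fderiv, ContinuousLinearMap.comp_apply, ← map_add]
      simp
    simp only [coneMean, restrict_closedBall_sphereMeasure, sub_zero, hgrad, hw₀, freeWave]
  have hend : coneMean T w t x t = w t x := by
    simp [coneMean, restrict_closedBall_sphereMeasure]
  obtain ⟨hcone, hmaps⟩ := continuousOn_backwardCone ht.2 x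
  have hsource : ContinuousOn
      (fun s => (t - s) * ∫ z, h s (x + (t - s) • z) ∂sphereMeasure E3) (Icc 0 t) := by
    refine ContinuousOn.mul (by fun_prop) ?_
    simpa only [restrict_closedBall_sphereMeasure] using continuousOn_setIntegral_of_isCompact
      (μ := sphereMeasure E3) (F := fun s z => h s (x + (t - s) • z)) (isCompact_closedBall 0 1)
      (hh.comp hcone hmaps)
  have hFTC := intervalIntegral.integral_eq_sub_of_hasDerivAt_of_le
    (f := coneMean T w t x) ht.1
    (continuousOn_setIntegral_of_isCompact (isCompact_closedBall _ _)
      (hw.continuousOn_coneIntegrand hT ht.2 x)) (fun s hs => hw.hasDerivAt_coneMean hT ht.2 x hs)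
    (hsource.intervalIntegrable_of_Icc ht.1)
  rw [retardedPotential, hFTC, hstart, hend, add_sub_cancel]

end Kirchhoff

section SmoothPotentials

theorem contDiff_freeWave {w₀ w₁ : E3 → ℝ} (hw₀ : ContDiff ℝ ∞ w₀) (hw₁ : ContDiff ℝ ∞ w₁) :
    ContDiff ℝ ∞ (Function.uncurry (freeWave w₀ w₁)) := by
  have : ContDiff ℝ ∞ (fderiv ℝ w₀) := hw₀.fderiv_right (by simp)
  have key := contDiffOn_setIntegral (μ := sphereMeasure E3) (n := ⊤) (convex_univ (E := ℝ × E3))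
    uniqueDiffOn_univ uniqueDiffOn_univ (isCompact_closedBall (0 : E3) 1) (subset_univ _)
    (F := fun q : (ℝ × E3) × E3 => w₀ (q.1.2 + q.1.1 • q.2) + q.1.1 *
      (w₁ (q.1.2 + q.1.1 • q.2) + fderiv ℝ w₀ (q.1.2 + q.1.1 • q.2) q.2))
    (ContDiff.contDiffOn (by fun_prop))
  rw [restrict_closedBall_sphereMeasure] at key
  exact contDiffOn_univ.1 key

theorem retardedPotential_eq_sq_mul_integral (h : ℝ → E3 → ℝ) (t : ℝ) (x : E3) :
    retardedPotential h t x = t ^ 2 * ∫ a in Icc (0 : ℝ) 1, (1 - a) *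
      ∫ z in closedBall 0 1, h (t * a) (x + (t * (1 - a)) • z) ∂sphereMeasure E3 := by
  have hscale := intervalIntegral.smul_integral_comp_mul_left (a := 0) (b := 1)
    (fun s => (t - s) * ∫ z, h s (x + (t - s) • z) ∂sphereMeasure E3) t
  rw [mul_zero, mul_one] at hscale
  rw [retardedPotential, ← hscale, intervalIntegral.integral_of_le zero_le_one,
    ← integral_Icc_eq_integral_Ioc, sq, mul_assoc, ← integral_const_mul t,
    restrict_closedBall_sphereMeasure, smul_eq_mul]
  simp only [← mul_assoc, mul_one_sub]

variable {P : Type*} [NormedAddCommGroup P] [NormedSpace ℝ P] {T : ℝ} {h : P → ℝ → E3 → ℝ}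

theorem contDiffOn_comp_scaledCone
    (hh : ContDiffOn ℝ ∞ (fun q : (ℝ × E3) × P => h q.2 q.1.1 q.1.2) (slab T ×ˢ univ)) :
    ContDiffOn ℝ ∞ (fun q : (((ℝ × E3) × P) × ℝ) × E3 =>
      h q.1.1.2 (q.1.1.1.1 * q.1.2) (q.1.1.1.2 + (q.1.1.1.1 * (1 - q.1.2)) • q.2))
      (((slab T ×ˢ univ) ×ˢ Icc 0 1) ×ˢ univ) := by
  let coneMap (q : (((ℝ × E3) × P) × ℝ) × E3) : (ℝ × E3) × P :=
    ((q.1.1.1.1 * q.1.2, q.1.1.1.2 + (q.1.1.1.1 * (1 - q.1.2)) • q.2), q.1.1.2)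
  have hmaps : MapsTo coneMap (((slab T ×ˢ univ) ×ˢ Icc 0 1) ×ˢ univ) (slab T ×ˢ univ) := by
    rintro ⟨⟨⟨⟨t, x⟩, p⟩, a⟩, z⟩ ⟨⟨⟨⟨ht, -⟩, -⟩, ha⟩, -⟩
    exact ⟨mk_mem_slab ⟨mul_nonneg ht.1 ha.1, (mul_le_of_le_one_right ht.1 ha.2).trans ht.2⟩,
      mem_univ _⟩
  have hsmooth : ContDiff ℝ ∞ coneMap := by fun_prop
  exact hh.comp hsmooth.contDiffOn hmaps

theorem contDiffOn_retardedPotential (hT : 0 < T)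
    (hh : ContDiffOn ℝ ∞ (fun q : (ℝ × E3) × P => h q.2 q.1.1 q.1.2) (slab T ×ˢ univ)) :
    ContDiffOn ℝ ∞ (fun q : (ℝ × E3) × P => retardedPotential (h q.2) q.1.1 q.1.2)
      (slab T ×ˢ univ) := by
  have hconv : Convex ℝ (slab T ×ˢ (univ : Set P)) := convex_slab.prod convex_univ
  have hdiff : UniqueDiffOn ℝ (slab T ×ˢ (univ : Set P)) :=
    (uniqueDiffOn_slab hT).prod uniqueDiffOn_univ
  have hI : UniqueDiffOn ℝ (Icc (0 : ℝ) 1) := uniqueDiffOn_Icc one_pos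
  have hcone := contDiffOn_comp_scaledCone hh
  have hs := hconv.prod (convex_Icc (0 : ℝ) 1)
  have hs' := hdiff.prod hI
  have hmean := contDiffOn_setIntegral (μ := sphereMeasure E3) (n := ⊤) hs hs' uniqueDiffOn_univ
    (isCompact_closedBall (0 : E3) 1) (subset_univ _) hcone
  have hweight : ContDiff ℝ ∞ fun q : ((ℝ × E3) × P) × ℝ => 1 - q.2 := by fun_prop
  have hsq : ContDiff ℝ ∞ fun q : (ℝ × E3) × P => q.1.1 ^ 2 := by fun_prop
  have hradial := contDiffOn_setIntegral (μ := (volume : Measure ℝ)) (n := ⊤) hconv hdiff hI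
    isCompact_Icc subset_rfl (hweight.contDiffOn.mul hmean)
  simp only [retardedPotential_eq_sq_mul_integral]
  exact hsq.contDiffOn.mul hradial

end SmoothPotentials

section Newton

variable {ρ : E3 → ℝ} {R : ℝ}

/-- The fundamental solution of `-Δ` on `ℝ³`. -/
def newtonKernel (y : E3) : ℝ := (4 * Real.pi * ‖y‖)⁻¹

theorem locallyIntegrable_newtonKernel : LocallyIntegrable newtonKernel := by
  refine locallyIntegrable_of_norm_le_rpow (C := (4 * Real.pi)⁻¹) (α := 1) (by simp) (by simp)
    (.of_forall fun y => ?_) ?_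
  · rw [newtonKernel, Real.rpow_neg_one, mul_inv, Real.norm_of_nonneg (by positivity)]
  · unfold newtonKernel
    fun_prop

theorem newtonPotential_eq_integral_newtonKernel (ρ : E3 → ℝ) (x : E3) :
    newtonPotential ρ x = ∫ y, newtonKernel y * ρ (x + y) := by
  rw [newtonPotential, ← integral_add_left_eq_self _ x]
  simp [newtonKernel]

theorem integrable_newtonKernel_mul (hρ : Continuous ρ) (hc : HasCompactSupport ρ) (x : E3) :
    Integrable fun y => newtonKernel y * ρ (x + y) :=
  locallyIntegrable_newtonKernel.integrable_smul_right_of_hasCompactSupport (by fun_prop)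
    (hc.comp_homeomorph (Homeomorph.addLeft x))

theorem toSphere_real_univ_E3 :
    (volume : Measure E3).toSphere.real univ = 4 * Real.pi := by
  rw [Measure.toSphere_real_apply_univ, measureReal_def, EuclideanSpace.volume_ball_fin_three,
    ENNReal.toReal_mul, ENNReal.toReal_ofReal (by positivity), ENNReal.toReal_pow,
    ENNReal.toReal_ofReal zero_le_one, finrank_euclideanSpace_fin]
  ring

theorem lt_norm_add_smul {E : Type*} [NormedAddCommGroup E] [NormedSpace ℝ E] {x z : E} {r : ℝ}
    (hr : ‖x‖ + R < r) (hz : ‖z‖ = 1) : R < ‖x + r • z‖ := by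
  have h₁ : ‖r • z‖ ≤ ‖x + r • z‖ + ‖x‖ := by simpa using norm_sub_le (x + r • z) x
  rw [norm_smul, hz, mul_one] at h₁
  linarith [Real.le_norm_self r]

theorem newtonPotential_eq_retardedPotential (hρ : Continuous ρ) (hR : ∀ y, R < ‖y‖ → ρ y = 0)
    {t : ℝ} (ht : 0 ≤ t) {x : E3} (hx : ‖x‖ + R ≤ t) :
    newtonPotential ρ x = retardedPotential (fun _ => ρ) t x := by
  have hc : HasCompactSupport ρ :=
    .intro (isCompact_closedBall 0 R) fun y hy => hR y (by simpa using hy)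
  let mean (r : ℝ) : ℝ := ∫ z, ρ (x + r • z) ∂sphereMeasure E3
  have hmean {r : ℝ} (hr : t < r) : mean r = 0 :=
    integral_eq_zero_of_ae ((ae_sphereMeasure_norm_eq_one E3).mono fun z hz =>
      hR _ (lt_norm_add_smul (hx.trans_lt hr) hz))
  have hpolar (r : ℝ) (hr : r ∈ Ioi (0 : ℝ)) : r ^ 2 * ∫ z, newtonKernel (r • z) * ρ (x + r • z)
      ∂sphereMeasure E3 = (4 * Real.pi)⁻¹ * (r * mean r) := by
    have hr₀ : r ≠ 0 := (mem_Ioi.1 hr).ne'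
    rw [integral_congr_ae ((ae_sphereMeasure_norm_eq_one E3).mono fun z hz =>
      show _ = (4 * Real.pi * r)⁻¹ * ρ (x + r • z) by
        rw [newtonKernel, norm_smul, hz, Real.norm_of_nonneg (le_of_lt hr), mul_one]),
      integral_const_mul]
    field_simp
    rfl
  rw [newtonPotential_eq_integral_newtonKernel, integral_eq_smul_integral_Ioi_sphereMeasure
    (integrable_newtonKernel_mul hρ hc x), toSphere_real_univ_E3]
  simp only [finrank_euclideanSpace_fin, Nat.add_one_sub_one, smul_eq_mul]
  rw [setIntegral_congr_fun measurableSet_Ioi hpolar, integral_const_mul,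
    mul_inv_cancel_left₀ (by positivity), retardedPotential]
  have hflip := intervalIntegral.integral_comp_sub_left (a := 0) (b := t) (fun r => r * mean r) t
  rw [sub_self, sub_zero] at hflip
  rw [hflip, intervalIntegral.integral_of_le ht]
  refine setIntegral_eq_of_subset_of_forall_sdiff_eq_zero measurableSet_Ioi Ioc_subset_Ioi_self
    fun r hr => ?_
  rw [hmean (lt_of_not_ge fun h => hr.2 ⟨hr.1, h⟩), mul_zero]

theorem isWaveSolution_static (hρ : ContDiff ℝ 2 ρ) (T : ℝ) :
    IsWaveSolution T (fun _ => -Laplacian.laplacian ρ) ρ (fun _ => 0) (fun _ => ρ) where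
  contDiffOn_one := ((hρ.of_le one_le_two).comp contDiff_snd).contDiffOn
  contDiffOn_two := (hρ.comp contDiff_snd).contDiffOn
  equation t _ x := by simp [dAlembert, timeDeriv]
  initial _ := rfl
  initial_timeDeriv x := by simp [timeDeriv]

theorem freeWave_eq_zero_of_norm_add_lt {w₀ w₁ : E3 → ℝ} (h₀ : ∀ y, R < ‖y‖ → w₀ y = 0)
    (h₁ : ∀ y, R < ‖y‖ → w₁ y = 0) {t : ℝ} {x : E3} (hx : ‖x‖ + R < t) :
    freeWave w₀ w₁ t x = 0 := by
  refine integral_eq_zero_of_ae ((ae_sphereMeasure_norm_eq_one E3).mono fun z hz => ?_)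
  have hlt := lt_norm_add_smul hx hz
  have hnhds : w₀ =ᶠ[𝓝 (x + t • z)] fun _ => 0 :=
    mem_of_superset ((isOpen_lt continuous_const continuous_norm).mem_nhds hlt) h₀
  simp [h₀ _ hlt, h₁ _ hlt, hnhds.fderiv_eq]

theorem newtonPotential_laplacian (hρ : ContDiff ℝ 2 ρ) (hc : HasCompactSupport ρ) (x : E3) :
    newtonPotential (Laplacian.laplacian ρ) x = -ρ x := by
  -- `ρ` solves `□w = -Δρ`. For large `t` the free wave has left `x`, by Huygens' principle, and the
  -- retarded potential of the static source `-Δρ` has become its Newton potential.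
  obtain ⟨R, -, hR⟩ := hc.exists_pos_le_norm
  have hR' (y : E3) (hy : R < ‖y‖) : ρ y = 0 := hR y hy.le
  have hlap (y : E3) (hy : R < ‖y‖) : -Laplacian.laplacian ρ y = 0 := by
    have hnhds : ρ =ᶠ[𝓝 y] fun _ => 0 :=
      mem_of_superset ((isOpen_lt continuous_const continuous_norm).mem_nhds hy) hR'
    rw [(InnerProductSpace.laplacian_congr_nhds hnhds).eq_of_nhds]
    simp
  let t := max (‖x‖ + R + 1) 1
  have ht : 0 < t := lt_max_of_lt_right one_pos
  have hx : ‖x‖ + R < t := lt_max_of_lt_left (lt_add_one _)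
  have hcont : Continuous (-Laplacian.laplacian ρ) := (continuous_laplacian hρ).neg
  have hkirchhoff := (isWaveSolution_static hρ t).eq_freeWave_add_retardedPotential
    (hcont.comp continuous_snd).continuousOn ht ⟨ht.le, le_rfl⟩ x
  rw [freeWave_eq_zero_of_norm_add_lt hR' (fun _ _ => rfl) hx, zero_add,
    ← newtonPotential_eq_retardedPotential hcont hlap ht.le hx.le] at hkirchhoff
  simp [hkirchhoff, newtonPotential, integral_neg]

theorem newtonPotential_eq_convolution (ρ : E3 → ℝ) :
    newtonPotential ρ = convolution newtonKernel ρ (ContinuousLinearMap.mul ℝ ℝ) volume := by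
  funext x
  rw [newtonPotential_eq_integral_newtonKernel, convolution, ← integral_neg_eq_self]
  simp [newtonKernel, sub_eq_add_neg]

theorem contDiff_newtonPotential {n : ℕ∞} (hρ : ContDiff ℝ n ρ) (hc : HasCompactSupport ρ) :
    ContDiff ℝ n (newtonPotential ρ) := by
  rw [newtonPotential_eq_convolution]
  exact hc.contDiff_convolution_right _ locallyIntegrable_newtonKernel hρ

theorem hasCompactSupport_partialDeriv (hc : HasCompactSupport ρ) (i : Fin 3) :
    HasCompactSupport (partialDeriv i ρ) :=
  (hc.fderiv ℝ).comp_left (g := fun L : E3 →L[ℝ] ℝ => L (EuclideanSpace.single i 1)) (by simp)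

theorem contDiff_partialDeriv {n : ℕ∞} (hρ : ContDiff ℝ (n + 1) ρ) (i : Fin 3) :
    ContDiff ℝ n (partialDeriv i ρ) :=
  (hρ.fderiv_right le_rfl).clm_apply contDiff_const

theorem laplacian_eq_sum_partialDeriv {x : E3} (hρ : ContDiffAt ℝ 2 ρ x) :
    Laplacian.laplacian ρ x = ∑ i, partialDeriv i (partialDeriv i ρ) x := by
  rw [InnerProductSpace.laplacian_eq_iteratedFDeriv_orthonormalBasis ρ
    (EuclideanSpace.basisFun (Fin 3) ℝ)]
  refine Finset.sum_congr rfl fun i _ => ?_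
  have hd : DifferentiableAt ℝ (fderiv ℝ ρ) x :=
    (hρ.fderiv_right (m := 1) le_rfl).differentiableAt one_ne_zero
  have hi : HasFDerivAt (partialDeriv i ρ) _ x :=
    hd.hasFDerivAt.clm_apply (hasFDerivAt_const (EuclideanSpace.single i 1) x)
  rw [partialDeriv, hi.fderiv]
  simp [iteratedFDeriv_two_apply]

theorem partialDeriv_newtonPotential (hρ : ContDiff ℝ 1 ρ) (hc : HasCompactSupport ρ)
    (i : Fin 3) : partialDeriv i (newtonPotential ρ) = newtonPotential (partialDeriv i ρ) := by
  funext x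
  rw [newtonPotential_eq_convolution, newtonPotential_eq_convolution, partialDeriv,
    (hc.hasFDerivAt_convolution_right _ locallyIntegrable_newtonKernel hρ x).fderiv,
    convolution_precompR_apply _ locallyIntegrable_newtonKernel (hc.fderiv ℝ)
      (hρ.continuous_fderiv one_ne_zero)]
  rfl

theorem laplacian_newtonPotential (hρ : ContDiff ℝ 2 ρ) (hc : HasCompactSupport ρ) (x : E3) :
    Laplacian.laplacian (newtonPotential ρ) x = -ρ x := by
  have hρ' (i : Fin 3) : ContDiff ℝ 1 (partialDeriv i ρ) := contDiff_partialDeriv (n := 1) hρ i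
  have hc' (i : Fin 3) := hasCompactSupport_partialDeriv hc i
  rw [← newtonPotential_laplacian hρ hc, laplacian_eq_sum_partialDeriv
    (contDiff_newtonPotential (n := 2) hρ hc).contDiffAt]
  simp only [partialDeriv_newtonPotential (hρ.of_le one_le_two) hc,
    partialDeriv_newtonPotential (hρ' _) (hc' _), newtonPotential_eq_integral_newtonKernel,
    laplacian_eq_sum_partialDeriv hρ.contDiffAt, Finset.mul_sum]
  exact (integral_finsetSum _ fun i _ => integrable_newtonKernel_mul
    (contDiff_partialDeriv (n := 0) (hρ' i) i).continuous
    (hasCompactSupport_partialDeriv (hc' i) i) x).symm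

end Newton

section FormalMaxwell

variable {R M N : Type*} [CommRing R] [AddCommGroup M] [Module R M] [AddCommGroup N] [Module R N]
  (D₀ : Module.End R M) (D : Fin 3 → Module.End R M) (Φ : M) (A : Fin 3 → M)

/-- The d'Alembert operator built from abstract time and space derivatives. -/
def formalWave : Module.End R M := D₀ * D₀ - ∑ i, D i * D i

/-- The divergence built from abstract space derivatives. -/
def formalDiv : M := ∑ i, D i (A i)

/-- The curl built from abstract space derivatives; indices are taken modulo three. -/
def formalCurl (i : Fin 3) : M := D (i + 1) (A (i + 2)) - D (i + 2) (A (i + 1))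

/-- The Lorentz gauge expression `∂ₜφ + div A` built from abstract derivatives. -/
def formalGauge : M := D₀ Φ + formalDiv D A

/-- The electric field `-∂ₜA - ∇φ` built from abstract derivatives. -/
def formalElectric (i : Fin 3) : M := -D₀ (A i) - D i Φ

variable {D₀ D} in
theorem map_formalWave {D₀' : Module.End R N} {D' : Fin 3 → Module.End R N} {L : M →ₗ[R] N}
    (h₀ : ∀ a, L (D₀ a) = D₀' (L a)) (h : ∀ i a, L (D i a) = D' i (L a)) (a : M) :
    L (formalWave D₀ D a) = formalWave D₀' D' (L a) := by
  simp [formalWave, h₀, h]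

variable {D₀ D}

theorem formalDiv_formalCurl (hD : ∀ i j, Commute (D i) (D j)) :
    formalDiv D (formalCurl D A) = 0 := by
  have hcomm (i j : Fin 3) (a : M) : D i (D j a) = D j (D i a) := LinearMap.congr_fun (hD i j).eq a
  simp only [formalDiv, formalCurl, Fin.sum_univ_three, map_sub, Fin.isValue, Fin.reduceAdd,
    hcomm 1 0, hcomm 2 0, hcomm 2 1]
  abel

theorem formalCurl_formalElectric (hD₀ : ∀ i, Commute D₀ (D i))
    (hD : ∀ i j, Commute (D i) (D j)) (i : Fin 3) :
    D₀ (formalCurl D A i) + formalCurl D (formalElectric D₀ D Φ A) i = 0 := by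
  have hcomm₀ (i : Fin 3) (a : M) : D₀ (D i a) = D i (D₀ a) := LinearMap.congr_fun (hD₀ i).eq a
  have hcomm : D (i + 1) (D (i + 2) Φ) = D (i + 2) (D (i + 1) Φ) :=
    LinearMap.congr_fun (hD _ _).eq Φ
  simp only [formalCurl, formalElectric, map_sub, map_neg, hcomm₀, hcomm]
  abel

theorem formalDiv_formalElectric (hD₀ : ∀ i, Commute D₀ (D i)) :
    formalDiv D (formalElectric D₀ D Φ A) =
      formalWave D₀ D Φ - D₀ (formalGauge D₀ D Φ A) := by
  have hcomm₀ (i : Fin 3) (a : M) : D₀ (D i a) = D i (D₀ a) := LinearMap.congr_fun (hD₀ i).eq a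
  simp only [formalDiv, formalElectric, formalWave, formalGauge, map_sub, map_neg, map_add,
    map_sum, hcomm₀, Finset.sum_sub_distrib, Finset.sum_neg_distrib, LinearMap.sub_apply,
    LinearMap.sum_apply, Module.End.mul_apply]
  abel

theorem formalCurl_formalCurl (hD : ∀ i j, Commute (D i) (D j)) (i : Fin 3) :
    formalCurl D (formalCurl D A) i = D i (formalDiv D A) - ∑ j, D j (D j (A i)) := by
  have hcomm (i j : Fin 3) (a : M) : D i (D j a) = D j (D i a) := LinearMap.congr_fun (hD i j).eq a
  fin_cases i <;>
    simp only [formalDiv, formalCurl, Fin.sum_univ_three, map_sub, map_add, Fin.zero_eta,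
      Fin.mk_one, Fin.reduceFinMk, Fin.isValue, Fin.reduceAdd, zero_add, hcomm 1 0, hcomm 2 0,
      hcomm 2 1] <;>
    abel

theorem formalElectric_sub_formalCurl (hD₀ : ∀ i, Commute D₀ (D i))
    (hD : ∀ i j, Commute (D i) (D j)) (i : Fin 3) :
    D₀ (formalElectric D₀ D Φ A i) - formalCurl D (formalCurl D A) i =
      -formalWave D₀ D (A i) - D i (formalGauge D₀ D Φ A) := by
  have hcomm₀ : D₀ (D i Φ) = D i (D₀ Φ) := LinearMap.congr_fun (hD₀ i).eq Φ
  simp only [formalCurl_formalCurl A hD, formalElectric, formalWave, formalGauge, map_sub, map_neg,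
    map_add, hcomm₀, LinearMap.sub_apply, LinearMap.sum_apply, Module.End.mul_apply]
  abel

theorem formalWave_formalGauge (hD₀ : ∀ i, Commute D₀ (D i)) (hD : ∀ i j, Commute (D i) (D j)) :
    formalWave D₀ D (formalGauge D₀ D Φ A) =
      D₀ (formalWave D₀ D Φ) + ∑ i, D i (formalWave D₀ D (A i)) := by
  have hwave₀ : Commute (formalWave D₀ D) D₀ :=
    ((Commute.refl D₀).mul_left (.refl D₀)).sub_left
      (.sum_left _ _ _ fun i _ => (hD₀ i).symm.mul_left (hD₀ i).symm)
  have hwave (i : Fin 3) : Commute (formalWave D₀ D) (D i) :=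
    ((hD₀ i).mul_left (hD₀ i)).sub_left (.sum_left _ _ _ fun j _ => (hD j i).mul_left (hD j i))
  have hwave_apply (i : Fin 3) (a : M) : formalWave D₀ D (D i a) = D i (formalWave D₀ D a) :=
    LinearMap.congr_fun (hwave i).eq a
  rw [formalGauge, formalDiv, map_add, map_sum]
  simp only [hwave_apply]
  exact congrArg (· + _) (LinearMap.congr_fun hwave₀.eq Φ)

end FormalMaxwell

section SmoothOn

variable {V : Type*} [NormedAddCommGroup V] [NormedSpace ℝ V] {S : Set V} {p : V}

/-- The space of functions that are smooth on `S`. They are required to vanish off `S`, so that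
functions which agree on `S` are equal. -/
def smoothOn (S : Set V) : Submodule ℝ (V → ℝ) where
  carrier := {g | ContDiffOn ℝ ∞ g S ∧ ∀ p ∉ S, g p = 0}
  add_mem' hg hh := ⟨hg.1.add hh.1, fun p hp => by simp [hg.2 p hp, hh.2 p hp]⟩
  zero_mem' := ⟨contDiffOn_const, fun _ _ => rfl⟩
  smul_mem' c _ hg := ⟨contDiffOn_const.smul hg.1, fun p hp => by simp [hg.2 p hp]⟩

namespace smoothOn

theorem ext {g h : smoothOn S} (H : ∀ p ∈ S, g.1 p = h.1 p) : g = h := by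
  refine Subtype.ext (funext fun p => ?_)
  by_cases hp : p ∈ S
  · exact H p hp
  · rw [g.2.2 p hp, h.2.2 p hp]

theorem differentiableWithinAt (g : smoothOn S) (hp : p ∈ S) :
    DifferentiableWithinAt ℝ g.1 S p :=
  g.2.1.differentiableOn (by simp) p hp

/-- The element of `smoothOn S` which agrees on `S` with a given smooth function. -/
def restrict (g : V → ℝ) (hg : ContDiffOn ℝ ∞ g S) : smoothOn S :=
  ⟨S.indicator g, hg.congr fun _ hp => indicator_of_mem hp g,
    fun _ hp => indicator_of_notMem hp g⟩

theorem restrict_apply {g : V → ℝ} {hg : ContDiffOn ℝ ∞ g S} (hp : p ∈ S) :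
    (restrict g hg).1 p = g p :=
  indicator_of_mem hp g

variable (hS : UniqueDiffOn ℝ S)

/-- The derivative in the direction `v`, one-sided at the boundary of `S`. -/
def dirDeriv (v : V) : Module.End ℝ (smoothOn S) where
  toFun g := restrict (fun p => fderivWithin ℝ g.1 S p v)
    ((g.2.1.fderivWithin hS (by simp)).clm_apply contDiffOn_const)
  map_add' g h := ext fun p hp => by
    simp [restrict_apply hp, fderivWithin_add (hS p hp) (differentiableWithinAt g hp)
      (differentiableWithinAt h hp)]
  map_smul' c g := ext fun p hp => by
    simp [restrict_apply hp, fderivWithin_const_smul (hS p hp) (differentiableWithinAt g hp)]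

theorem dirDeriv_apply (v : V) (g : smoothOn S) (hp : p ∈ S) :
    (dirDeriv hS v g).1 p = fderivWithin ℝ g.1 S p v :=
  indicator_of_mem hp fun p => fderivWithin ℝ g.1 S p v

theorem commute_dirDeriv (hS' : S ⊆ closure (interior S)) (v w : V) :
    Commute (dirDeriv hS v) (dirDeriv hS w) := by
  refine LinearMap.ext fun g => ext fun p hp => ?_
  have hdiff : DifferentiableWithinAt ℝ (fderivWithin ℝ g.1 S) S p :=
    (g.2.1.fderivWithin hS (m := ∞) (by simp)).differentiableOn (by simp) p hp
  have hsecond (v w : V) : (dirDeriv hS v (dirDeriv hS w g)).1 p =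
      fderivWithin ℝ (fderivWithin ℝ g.1 S) S p v w := by
    have happly : HasFDerivWithinAt (dirDeriv hS w g).1 _ S p :=
      (hdiff.hasFDerivWithinAt.clm_apply (hasFDerivWithinAt_const w p S)).congr
        (fun q hq => dirDeriv_apply hS w g hq) (dirDeriv_apply hS w g hp)
    rw [dirDeriv_apply hS v _ hp, happly.fderivWithin (hS p hp)]
    simp
  rw [Module.End.mul_apply, Module.End.mul_apply, hsecond, hsecond]
  exact ((g.2.1 p hp).isSymmSndFDerivWithinAt (by simpa using ENat.LEInfty.out) hS (hS' hp) hp) v w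

end smoothOn

end SmoothOn

section SlabCalculus

variable {T t : ℝ} {x : E3}

theorem slab_subset_closure_interior (hT : 0 < T) : slab T ⊆ closure (interior (slab T)) := by
  rw [slab, interior_prod_eq, closure_prod_eq, interior_Icc, closure_Ioo hT.ne]
  simp

/-- The time derivative of smooth functions on the slab. -/
def slabTimeDeriv (hT : 0 < T) : Module.End ℝ (smoothOn (slab T)) :=
  smoothOn.dirDeriv (uniqueDiffOn_slab hT) (1, 0)

/-- The partial derivative of smooth functions on the slab in the `i`-th space direction. -/
def slabPartial (hT : 0 < T) (i : Fin 3) : Module.End ℝ (smoothOn (slab T)) :=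
  smoothOn.dirDeriv (uniqueDiffOn_slab hT) (0, EuclideanSpace.single i 1)

theorem commute_slabTimeDeriv_slabPartial (hT : 0 < T) (i : Fin 3) :
    Commute (slabTimeDeriv hT) (slabPartial hT i) :=
  smoothOn.commute_dirDeriv _ (slab_subset_closure_interior hT) _ _

theorem commute_slabPartial (hT : 0 < T) (i j : Fin 3) :
    Commute (slabPartial hT i) (slabPartial hT j) :=
  smoothOn.commute_dirDeriv _ (slab_subset_closure_interior hT) _ _

/-- `g` represents `w` if the two functions agree on the slab. Values of `w` at times outside
`[0, T]` are irrelevant. -/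
def Represents (g : smoothOn (slab T)) (w : ℝ → E3 → ℝ) : Prop :=
  ∀ t ∈ Icc 0 T, ∀ x, w t x = g.1 (t, x)

theorem represents_restrict {w : ℝ → E3 → ℝ}
    (hw : ContDiffOn ℝ ∞ (Function.uncurry w) (slab T)) :
    Represents (smoothOn.restrict _ hw) w :=
  fun _ ht _ => (smoothOn.restrict_apply (g := Function.uncurry w) (mk_mem_slab ht)).symm

namespace Represents

variable {g : smoothOn (slab T)} {w : ℝ → E3 → ℝ}

theorem contDiffOn (hw : Represents g w) : ContDiffOn ℝ ∞ (Function.uncurry w) (slab T) :=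
  g.2.1.congr fun p hp => hw p.1 hp.1 p.2

theorem differentiableWithinAt (hw : Represents g w) (ht : t ∈ Icc 0 T) :
    DifferentiableWithinAt ℝ (Function.uncurry w) (slab T) (t, x) :=
  hw.contDiffOn.differentiableOn (by simp) _ (mk_mem_slab ht)

theorem fderivWithin_eq (hw : Represents g w) (ht : t ∈ Icc 0 T) :
    fderivWithin ℝ (Function.uncurry w) (slab T) (t, x) = fderivWithin ℝ g.1 (slab T) (t, x) :=
  fderivWithin_congr (fun p hp => hw p.1 hp.1 p.2) (hw t ht x)

protected theorem timeDeriv (hT : 0 < T) (hw : Represents g w) :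
    Represents (slabTimeDeriv hT g) (timeDeriv T w) := fun t ht x => by
  rw [timeDeriv_eq_fderivWithin_slab hT ht (hw.differentiableWithinAt ht), hw.fderivWithin_eq ht,
    slabTimeDeriv, smoothOn.dirDeriv_apply _ _ _ (mk_mem_slab ht)]

protected theorem partialDeriv (hT : 0 < T) (hw : Represents g w) (i : Fin 3) :
    Represents (slabPartial hT i g) fun t => partialDeriv i (w t) := fun t ht x => by
  dsimp only [VlasovMaxwell.partialDeriv]
  rw [(hasFDerivAt_of_differentiableWithinAt_slab ht
    (hw.differentiableWithinAt ht)).fderiv, hw.fderivWithin_eq ht, slabPartial,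
    smoothOn.dirDeriv_apply _ _ _ (mk_mem_slab ht)]
  simp

theorem contDiff_apply (hw : Represents g w) (ht : t ∈ Icc 0 T) : ContDiff ℝ ∞ (w t) :=
  hw.contDiffOn.comp_contDiff (contDiff_const.prodMk contDiff_id) fun _ => mk_mem_slab ht

protected theorem laplacian (hT : 0 < T) (hw : Represents g w) :
    Represents (∑ i, slabPartial hT i (slabPartial hT i g))
      fun t => Laplacian.laplacian (w t) := fun t ht x => by
  dsimp only
  rw [laplacian_eq_sum_partialDeriv ((hw.contDiff_apply ht).of_le ENat.LEInfty.out).contDiffAt]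
  simp [((hw.partialDeriv hT _).partialDeriv hT _) t ht x]

protected theorem dAlembert (hT : 0 < T) (hw : Represents g w) :
    Represents (formalWave (slabTimeDeriv hT) (slabPartial hT) g) (dAlembert T w) :=
  fun t ht x => by
    simp [dAlembert, formalWave, ((hw.timeDeriv hT).timeDeriv hT) t ht x,
      hw.laplacian hT t ht x]

theorem isWaveSolution (hT : 0 < T) (hw : Represents g w) :
    IsWaveSolution T (Function.curry (formalWave (slabTimeDeriv hT) (slabPartial hT) g).1)
      (w 0) (timeDeriv T w 0) w where
  contDiffOn_one := hw.contDiffOn.of_le (by simp)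
  contDiffOn_two := (hw.contDiffOn.of_le ENat.LEInfty.out).mono
    (prod_mono_left Ioo_subset_Icc_self)
  equation t ht x := hw.dAlembert hT t (Ioo_subset_Icc_self ht) x
  initial _ := rfl
  initial_timeDeriv _ := rfl

end Represents

/-- Componentwise representation of vector fields on the slab. -/
def RepresentsField (G : Fin 3 → smoothOn (slab T)) (F : ℝ → E3 → E3) : Prop :=
  ∀ i, Represents (G i) fun t x => F t x i

theorem gradient_apply (q : E3 → ℝ) (x : E3) (i : Fin 3) :
    gradient q x i = partialDeriv i q x := by
  have hinner := InnerProductSpace.toDual_symm_apply (𝕜 := ℝ) (E := E3)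
    (x := EuclideanSpace.single i 1) (y := fderiv ℝ q x)
  rw [EuclideanSpace.inner_single_right] at hinner
  simpa [gradient, partialDeriv] using hinner

theorem curl_apply (F : E3 → E3) (x : E3) (i : Fin 3) : curl F x i =
    partialDeriv (i + 1) (fun y => F y (i + 2)) x -
      partialDeriv (i + 2) (fun y => F y (i + 1)) x := by
  fin_cases i <;> rfl

theorem Represents.gradient (hT : 0 < T) {g : smoothOn (slab T)} {w : ℝ → E3 → ℝ}
    (hw : Represents g w) :
    RepresentsField (fun i => slabPartial hT i g) fun t => gradient (w t) := fun i t ht x => by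
  simp [gradient_apply, hw.partialDeriv hT i t ht x]

namespace RepresentsField

variable {G : Fin 3 → smoothOn (slab T)} {F : ℝ → E3 → E3}

theorem contDiffOn (hF : RepresentsField G F) :
    ContDiffOn ℝ ∞ (Function.uncurry F) (slab T) :=
  contDiffOn_euclidean.2 fun i => (hF i).contDiffOn

theorem sub {G' : Fin 3 → smoothOn (slab T)} {F' : ℝ → E3 → E3} (hF : RepresentsField G F)
    (hF' : RepresentsField G' F') : RepresentsField (fun i => G i - G' i) (F - F') :=
  fun i t ht x => by simp [hF i t ht x, hF' i t ht x]

theorem neg (hF : RepresentsField G F) : RepresentsField (fun i => -G i) (-F) :=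
  fun i t ht x => by simp [hF i t ht x]

protected theorem timeDeriv (hT : 0 < T) (hF : RepresentsField G F) :
    RepresentsField (fun i => slabTimeDeriv hT (G i)) (timeDeriv T F) := fun i t ht x => by
  have hdiff : DifferentiableWithinAt ℝ (fun s => F s x) (Icc 0 T) t :=
    (hF.contDiffOn.differentiableOn (by simp) _ (mk_mem_slab ht)).comp t
      (f := fun s => (s, x)) (by fun_prop) fun s hs => mk_mem_slab hs
  rw [← (hF i).timeDeriv hT t ht x]
  exact ((EuclideanSpace.proj i : E3 →L[ℝ] ℝ).hasFDerivAt.comp_hasDerivWithinAt t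
    hdiff.hasDerivWithinAt).derivWithin (uniqueDiffOn_Icc hT t ht) |>.symm

protected theorem divergence (hT : 0 < T) (hF : RepresentsField G F) :
    Represents (formalDiv (slabPartial hT) G) fun t => divergence (F t) := fun t ht x => by
  simp [divergence, formalDiv, (hF _).partialDeriv hT _ t ht x]

protected theorem curl (hT : 0 < T) (hF : RepresentsField G F) :
    RepresentsField (formalCurl (slabPartial hT) G) fun t => curl (F t) := fun i t ht x => by
  simp [curl_apply, formalCurl, (hF _).partialDeriv hT _ t ht x]

protected theorem electricField (hT : 0 < T) {Φ : smoothOn (slab T)} {φ : ℝ → E3 → ℝ}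
    (hφ : Represents Φ φ) (hF : RepresentsField G F) :
    RepresentsField (formalElectric (slabTimeDeriv hT) (slabPartial hT) Φ G)
      (electricField T φ F) :=
  (hF.timeDeriv hT).neg.sub (hφ.gradient hT)

end RepresentsField

theorem smoothOn.ext_of_eqOn_interior {V : Type*} [NormedAddCommGroup V] [NormedSpace ℝ V]
    {S : Set V} (hS : S ⊆ closure (interior S)) {g h : smoothOn S}
    (hgh : EqOn g.1 h.1 (interior S)) : g = h :=
  smoothOn.ext fun _ hp =>
    hgh.of_subset_closure g.2.1.continuousOn h.2.1.continuousOn interior_subset hS hp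

theorem formalWave_eq_of_isWaveSolution (hT : 0 < T) {g k : smoothOn (slab T)}
    {w h : ℝ → E3 → ℝ} {w₀ w₁ : E3 → ℝ} (hg : Represents g w) (hk : Represents k h)
    (hw : IsWaveSolution T h w₀ w₁ w) :
    formalWave (slabTimeDeriv hT) (slabPartial hT) g = k := by
  refine smoothOn.ext_of_eqOn_interior (slab_subset_closure_interior hT) fun ⟨t, x⟩ hp => ?_
  rw [slab, interior_prod_eq, interior_Icc] at hp
  have ht : t ∈ Icc 0 T := Ioo_subset_Icc_self hp.1
  rw [← hg.dAlembert hT t ht x, hw.equation t hp.1 x, hk t ht x]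

/-- Vanishing of `g` and of its time derivative at time `0`. -/
structure HasZeroCauchyData (hT : 0 < T) (g : smoothOn (slab T)) : Prop where
  initial : ∀ x, g.1 (0, x) = 0
  initial_timeDeriv : ∀ x, (slabTimeDeriv hT g).1 (0, x) = 0

theorem HasZeroCauchyData.eq_zero_of_formalWave_eq_zero {hT : 0 < T} {g : smoothOn (slab T)}
    (hg₀ : HasZeroCauchyData hT g)
    (hg : formalWave (slabTimeDeriv hT) (slabPartial hT) g = 0) : g = 0 := by
  have hrep : Represents g (Function.curry g.1) := fun _ _ _ => rfl
  have hwave := hrep.isWaveSolution hT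
  rw [hg] at hwave
  refine smoothOn.ext fun ⟨t, x⟩ hp => ?_
  have hkirchhoff := hwave.eq_freeWave_add_retardedPotential continuousOn_const hT hp.1 x
  have hvel (y : E3) : timeDeriv T (Function.curry g.1) 0 y = 0 :=
    (hrep.timeDeriv hT 0 (left_mem_Icc.2 hT.le) y).trans (hg₀.initial_timeDeriv y)
  have hpos : Function.curry g.1 0 = fun _ => 0 := funext hg₀.initial
  rw [hpos, funext hvel] at hkirchhoff
  simpa [freeWave, retardedPotential] using hkirchhoff

theorem slabPartial_initial_eq_zero (hT : 0 < T) {g : smoothOn (slab T)}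
    (hg : ∀ x, g.1 (0, x) = 0) (i : Fin 3) (x : E3) : (slabPartial hT i g).1 (0, x) = 0 := by
  have hrep : Represents g (Function.curry g.1) := fun _ _ _ => rfl
  have hpos : Function.curry g.1 0 = fun _ => 0 := funext hg
  rw [← hrep.partialDeriv hT i 0 (left_mem_Icc.2 hT.le) x]
  simp [partialDeriv, hpos]

end SlabCalculus

section LorentzForce

theorem contDiff_inv_sqrt_one_add_norm_sq {E : Type*} [NormedAddCommGroup E]
    [InnerProductSpace ℝ E] : ContDiff ℝ ∞ fun ξ : E => (√(1 + ‖ξ‖ ^ 2))⁻¹ := by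
  have hpos (ξ : E) : 0 < 1 + ‖ξ‖ ^ 2 := by positivity
  exact ((contDiff_const.add (contDiff_norm_sq ℝ)).sqrt fun ξ => (hpos ξ).ne').inv
    fun ξ => (Real.sqrt_pos.2 (hpos ξ)).ne'

theorem contDiff_velocity : ContDiff ℝ ∞ velocity :=
  contDiff_inv_sqrt_one_add_norm_sq.smul contDiff_id

theorem contDiff_velocity_apply (i : Fin 3) : ContDiff ℝ ∞ fun ξ => velocity ξ i :=
  contDiff_euclidean.1 contDiff_velocity i

theorem inner_self_apply_of_mem_skewAdjoint {E : Type*} [NormedAddCommGroup E]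
    [InnerProductSpace ℝ E] [CompleteSpace E] {K : E →L[ℝ] E} (hK : K ∈ skewAdjoint (E →L[ℝ] E))
    (x : E) : inner ℝ x (K x) = 0 := by
  have hadj : inner ℝ (K.adjoint x) x = inner ℝ x (K x) := K.adjoint_inner_left x x
  rw [← ContinuousLinearMap.star_eq_adjoint, skewAdjoint.mem_iff.1 hK, neg_apply, inner_neg_left,
    real_inner_comm] at hadj
  linarith

theorem fderiv_comp_norm_sq_of_mem_skewAdjoint {E : Type*} [NormedAddCommGroup E]
    [InnerProductSpace ℝ E] [CompleteSpace E] {K : E →L[ℝ] E} (hK : K ∈ skewAdjoint (E →L[ℝ] E))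
    {r : ℝ → ℝ} {x : E} (hr : DifferentiableAt ℝ r (‖x‖ ^ 2)) :
    fderiv ℝ (fun y => r (‖y‖ ^ 2)) x (K x) = 0 := by
  have hcomp := hr.hasDerivAt.comp_hasFDerivAt x (hasStrictFDerivAt_norm_sq x).hasFDerivAt
  rw [HasFDerivAt.fderiv (f := fun y => r (‖y‖ ^ 2)) hcomp]
  simp [inner_self_apply_of_mem_skewAdjoint hK]

/-- The map `ξ ↦ ξ × b`. -/
def crossRight (b : E3) : E3 →L[ℝ] E3 :=
  LinearMap.toContinuousLinearMap <| (WithLp.linearEquiv 2 ℝ (Fin 3 → ℝ)).symm.toLinearMap ∘ₗ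
    crossProduct.flip b.ofLp ∘ₗ (WithLp.linearEquiv 2 ℝ (Fin 3 → ℝ)).toLinearMap

theorem crossRight_apply (b ξ : E3) : crossRight b ξ = cross ξ b := rfl

theorem crossRight_mem_skewAdjoint (b : E3) : crossRight b ∈ skewAdjoint (E3 →L[ℝ] E3) := by
  rw [skewAdjoint.mem_iff, ContinuousLinearMap.star_eq_adjoint, eq_comm,
    ContinuousLinearMap.eq_adjoint_iff]
  intro ξ η
  simp [crossRight_apply, cross, PiLp.inner_apply, Fin.sum_univ_three, cross_apply]
  ring

theorem integral_fderiv_apply_eq_zero {E : Type*} [NormedAddCommGroup E] [NormedSpace ℝ E]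
    [FiniteDimensional ℝ E] [MeasurableSpace E] [BorelSpace E] {μ : Measure E} [μ.IsAddHaarMeasure]
    {g : E → ℝ} (hg : ContDiff ℝ 1 g) (hc : HasCompactSupport g) (v : E) :
    ∫ x, fderiv ℝ g x v ∂μ = 0 := by
  have hg' : Integrable (fun x => fderiv ℝ g x v) μ :=
    ((hg.continuous_fderiv one_ne_zero).clm_apply continuous_const).integrable_of_hasCompactSupport
      ((hc.fderiv ℝ).comp_left (g := fun L : E →L[ℝ] ℝ => L v) rfl)
  simpa using integral_mul_fderiv_eq_neg_fderiv_mul_of_integrable (μ := μ)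
    (f := fun _ : E => (1 : ℝ)) (g := g) (v := v) (by simp) (by simpa using hg')
    (by simpa using hg.continuous.integrable_of_hasCompactSupport hc)
    (fun _ _ => by fun_prop) (fun x _ => hg.differentiable one_ne_zero x)

variable {g : E3 → ℝ} {R : ℝ}

theorem setIntegral_fderiv_cross_velocity (hg : ContDiff ℝ 1 g) (R : ℝ) (b : E3) :
    ∫ ξ in closedBall 0 R, fderiv ℝ g ξ (cross (velocity ξ) b) = 0 := by
  have hγ : ContDiff ℝ 1 fun ξ : E3 => (√(1 + ‖ξ‖ ^ 2))⁻¹ :=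
    contDiff_inv_sqrt_one_add_norm_sq.of_le (by simp)
  have hrot (ξ : E3) : fderiv ℝ (fun η : E3 => (√(1 + ‖η‖ ^ 2))⁻¹) ξ (crossRight b ξ) = 0 := by
    have hpos : 0 < 1 + ‖ξ‖ ^ 2 := by positivity
    have hadd : DifferentiableAt ℝ (fun s : ℝ => 1 + s) (‖ξ‖ ^ 2) := by fun_prop
    exact fderiv_comp_norm_sq_of_mem_skewAdjoint (crossRight_mem_skewAdjoint b)
      (r := fun s : ℝ => (√(1 + s))⁻¹) ((hadd.sqrt hpos.ne').inv (Real.sqrt_pos.2 hpos).ne')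
  have hzero := setIntegral_closedBall_fderiv_skewAdjoint (μ := (volume : Measure E3))
    (fun U => U.measurePreserving) (crossRight_mem_skewAdjoint b) (hγ.mul hg) R
  rw [← hzero]
  refine integral_congr_ae (.of_forall fun ξ => ?_)
  dsimp only
  rw [fderiv_fun_mul (hγ.differentiable one_ne_zero ξ) (hg.differentiable one_ne_zero ξ)]
  simp [hrot, velocity, ← crossRight_apply]

theorem setIntegral_closedBall_fderiv_apply_eq_zero (hg : ContDiff ℝ 1 g)
    (hR : ∀ ξ, R < ‖ξ‖ → g ξ = 0) (e : E3) : ∫ ξ in closedBall 0 R, fderiv ℝ g ξ e = 0 := by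
  have hsupp : tsupport g ⊆ closedBall 0 R :=
    closure_minimal (fun ξ hξ => mem_closedBall_zero_iff.2 <| not_lt.1 <| mt (hR ξ) hξ)
      isClosed_closedBall
  rw [setIntegral_eq_integral_of_forall_compl_eq_zero fun ξ hξ => by
    rw [fderiv_of_notMem_tsupport (𝕜 := ℝ) fun h => hξ (hsupp h), zero_apply]]
  exact integral_fderiv_apply_eq_zero hg
    (HasCompactSupport.of_support_subset_isCompact (isCompact_closedBall 0 R)
      (subset_closure.trans hsupp)) e

theorem setIntegral_inner_lorentzForce_gradient (hg : ContDiff ℝ 1 g)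
    (hR : ∀ ξ, R < ‖ξ‖ → g ξ = 0) (e b : E3) :
    ∫ ξ in closedBall 0 R, inner ℝ (e + cross (velocity ξ) b) (gradient g ξ) = 0 := by
  have hforce (ξ : E3) : inner ℝ (e + cross (velocity ξ) b) (gradient g ξ) =
      fderiv ℝ g ξ e + fderiv ℝ g ξ (cross (velocity ξ) b) := by
    rw [real_inner_comm, gradient, InnerProductSpace.toDual_symm_apply, map_add]
  have hg' := hg.continuous_fderiv one_ne_zero
  have hcross : Continuous fun ξ => cross (velocity ξ) b :=
    (crossRight b).continuous.comp contDiff_velocity.continuous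
  simp only [hforce]
  rw [integral_add ((hg'.clm_apply continuous_const).continuousOn.integrableOn_compact
      (isCompact_closedBall 0 R)) ((hg'.clm_apply hcross).continuousOn.integrableOn_compact
      (isCompact_closedBall 0 R)), setIntegral_closedBall_fderiv_apply_eq_zero hg hR,
    setIntegral_fderiv_cross_velocity hg, add_zero]

end LorentzForce

namespace smoothOn

variable {V Q : Type*} [NormedAddCommGroup V] [NormedSpace ℝ V] [NormedAddCommGroup Q]
  [NormedSpace ℝ Q] {S : Set V} {p : V}

/-- The restriction of a smooth function of two variables to a fixed second variable. -/
def slice (a : Q) : smoothOn (S ×ˢ (univ : Set Q)) →ₗ[ℝ] smoothOn S where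
  toFun g := ⟨fun p => g.1 (p, a),
    g.2.1.comp (contDiffOn_id.prodMk contDiffOn_const) fun _ hp => mk_mem_prod hp (mem_univ a),
    fun _ hp => g.2.2 _ fun h => hp h.1⟩
  map_add' _ _ := rfl
  map_smul' _ _ := rfl

theorem contDiffOn_mul_snd {m : Q → ℝ} (hm : ContDiff ℝ ∞ m)
    (g : smoothOn (S ×ˢ (univ : Set Q))) :
    ContDiffOn ℝ ∞ (fun q : V × Q => m q.2 * g.1 q) (S ×ˢ univ) :=
  (hm.comp contDiff_snd).contDiffOn.mul g.2.1

variable (hS : UniqueDiffOn ℝ S)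

theorem slice_dirDeriv (a : Q) (v : V) (g : smoothOn (S ×ˢ (univ : Set Q))) :
    slice a (dirDeriv (hS.prod uniqueDiffOn_univ) (v, 0) g) = dirDeriv hS v (slice a g) :=
  ext fun p hp => by
    have hslice := hasFDerivWithinAt_prodMk_left
      (differentiableWithinAt g (mk_mem_prod hp (mem_univ a))).hasFDerivWithinAt (mem_univ a)
    rw [dirDeriv_apply hS v _ hp, HasFDerivWithinAt.fderivWithin (f := (slice a g).1) hslice
      (hS p hp)]
    exact dirDeriv_apply (hS.prod uniqueDiffOn_univ) _ g (mk_mem_prod hp (mem_univ a))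

section Moment

variable [MeasurableSpace Q] [OpensMeasurableSpace Q] {A : Set Q} {m : Q → ℝ}
  (μ : Measure Q) [IsFiniteMeasureOnCompacts μ]

theorem integrableOn_mul_apply (hA : IsCompact A) (hm : ContDiff ℝ ∞ m) (hp : p ∈ S)
    (g : smoothOn (S ×ˢ (univ : Set Q))) : IntegrableOn (fun a => m a * g.1 (p, a)) A μ :=
  (hm.continuous.mul <| continuousOn_univ.1 <| g.2.1.continuousOn.comp (by fun_prop) fun a _ =>
    mk_mem_prod hp (mem_univ a)).continuousOn.integrableOn_compact hA

/-- The moment `p ↦ ∫ a in A, m a * g (p, a)` of a smooth function `g` of two variables. -/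
def moment (hS' : Convex ℝ S) (hA : IsCompact A) (hm : ContDiff ℝ ∞ m) :
    smoothOn (S ×ˢ (univ : Set Q)) →ₗ[ℝ] smoothOn S where
  toFun g := restrict (fun p => ∫ a in A, m a * g.1 (p, a) ∂μ)
    (contDiffOn_setIntegral hS' hS uniqueDiffOn_univ hA (subset_univ A) (contDiffOn_mul_snd hm g))
  map_add' g h := ext fun p hp => by
    simp [restrict_apply hp, mul_add, integral_add (integrableOn_mul_apply μ hA hm hp g)
      (integrableOn_mul_apply μ hA hm hp h)]
  map_smul' c g := ext fun p hp => by
    simp [restrict_apply hp, mul_left_comm _ c, integral_const_mul]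

variable {hS' : Convex ℝ S} {hA : IsCompact A} {hm : ContDiff ℝ ∞ m}

theorem moment_apply (g : smoothOn (S ×ˢ (univ : Set Q))) (hp : p ∈ S) :
    (moment hS μ hS' hA hm g).1 p = ∫ a in A, m a * g.1 (p, a) ∂μ :=
  indicator_of_mem hp fun p => ∫ a in A, m a * g.1 (p, a) ∂μ

theorem moment_dirDeriv (v : V) (g : smoothOn (S ×ˢ (univ : Set Q))) :
    moment hS μ hS' hA hm (dirDeriv (hS.prod uniqueDiffOn_univ) (v, 0) g) =
      dirDeriv hS v (moment hS μ hS' hA hm g) := by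
  refine ext fun p hp => ?_
  have hU : UniqueDiffOn ℝ (S ×ˢ (univ : Set Q)) := hS.prod uniqueDiffOn_univ
  set G : V × Q → ℝ := fun q => m q.2 * g.1 q
  have hG : ContDiffOn ℝ ∞ G (S ×ˢ univ) := contDiffOn_mul_snd hm g
  have hderiv (a : Q) : fderivWithin ℝ G (S ×ˢ univ) (p, a) (v, 0) =
      m a * (dirDeriv hU (v, 0) g).1 (p, a) := by
    have hpa := mk_mem_prod hp (mem_univ a)
    have hmul := ((hm.differentiable (by simp) a).hasFDerivAt.comp_hasFDerivWithinAt (p, a)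
      hasFDerivWithinAt_snd).mul (differentiableWithinAt g hpa).hasFDerivWithinAt
    rw [HasFDerivWithinAt.fderivWithin (f := G) hmul (hU _ hpa), dirDeriv_apply hU _ g hpa]
    simp
  have hcont : ContinuousOn (fun a => fderivWithin ℝ G (S ×ˢ univ) (p, a) ∘L .inl ℝ V Q) A :=
    ((hG.continuousOn_fderivWithin hU (by simp)).comp (by fun_prop) fun a _ =>
      mk_mem_prod hp (mem_univ a)).clm_comp continuousOn_const
  have hint := (hasFDerivWithinAt_setIntegral_of_contDiffOn (μ := μ) hS' hS uniqueDiffOn_univ hA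
    (subset_univ A) (hG.of_le (by simp)) hp).congr (f₁ := (moment hS μ hS' hA hm g).1)
    (fun q hq => moment_apply hS μ g hq) (moment_apply hS μ g hp)
  rw [dirDeriv_apply hS v _ hp, hint.fderivWithin (hS p hp), moment_apply hS μ _ hp,
    ContinuousLinearMap.integral_apply (hcont.integrableOn_compact hA)]
  simp [hderiv]

end Moment

end smoothOn

section Kinetic

variable {T R : ℝ} (hT : 0 < T)

/-- The smooth functions of time, position and momentum, on `[0, T] × ℝ³ × ℝ³`. -/
abbrev phaseFunctions (T : ℝ) : Submodule ℝ ((ℝ × E3) × E3 → ℝ) :=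
  smoothOn (slab T ×ˢ (univ : Set E3))

/-- The time derivative of smooth functions on phase space. -/
def phaseTimeDeriv : Module.End ℝ (phaseFunctions T) :=
  smoothOn.dirDeriv ((uniqueDiffOn_slab hT).prod uniqueDiffOn_univ) ((1, 0), 0)

/-- The partial derivative of smooth functions on phase space in the `i`-th position variable. -/
def phasePartial (i : Fin 3) : Module.End ℝ (phaseFunctions T) :=
  smoothOn.dirDeriv ((uniqueDiffOn_slab hT).prod uniqueDiffOn_univ)
    ((0, EuclideanSpace.single i 1), 0)

theorem slice_formalWave (ξ : E3) (F : phaseFunctions T) :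
    smoothOn.slice ξ (formalWave (phaseTimeDeriv hT) (phasePartial hT) F) =
      formalWave (slabTimeDeriv hT) (slabPartial hT) (smoothOn.slice ξ F) :=
  map_formalWave (fun F => smoothOn.slice_dirDeriv _ ξ _ F)
    (fun _ F => smoothOn.slice_dirDeriv _ ξ _ F) F

/-- The moment `(t, x) ↦ ∫ m(ξ) F(t, x, ξ) dξ` over momenta `ξ` with `‖ξ‖ ≤ R`. -/
def momentumMoment (R : ℝ) {m : E3 → ℝ} (hm : ContDiff ℝ ∞ m) :
    phaseFunctions T →ₗ[ℝ] smoothOn (slab T) :=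
  smoothOn.moment (uniqueDiffOn_slab hT) volume convex_slab (isCompact_closedBall 0 R) hm

section

variable {m : E3 → ℝ} {hm : ContDiff ℝ ∞ m}

theorem momentumMoment_apply {t : ℝ} (ht : t ∈ Icc 0 T) (x : E3) (F : phaseFunctions T) :
    (momentumMoment hT R hm F).1 (t, x) = ∫ ξ in closedBall 0 R, m ξ * F.1 ((t, x), ξ) :=
  smoothOn.moment_apply _ _ F (mk_mem_slab ht)

theorem momentumMoment_phaseTimeDeriv (F : phaseFunctions T) :
    momentumMoment hT R hm (phaseTimeDeriv hT F) = slabTimeDeriv hT (momentumMoment hT R hm F) :=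
  smoothOn.moment_dirDeriv _ _ _ F

theorem momentumMoment_phasePartial (i : Fin 3) (F : phaseFunctions T) :
    momentumMoment hT R hm (phasePartial hT i F) = slabPartial hT i (momentumMoment hT R hm F) :=
  smoothOn.moment_dirDeriv _ _ _ F

theorem momentumMoment_formalWave (F : phaseFunctions T) :
    momentumMoment hT R hm (formalWave (phaseTimeDeriv hT) (phasePartial hT) F) =
      formalWave (slabTimeDeriv hT) (slabPartial hT) (momentumMoment hT R hm F) :=
  map_formalWave (momentumMoment_phaseTimeDeriv hT) (momentumMoment_phasePartial hT) F

theorem HasZeroCauchyData.momentumMoment {F : phaseFunctions T}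
    (hF : ∀ ξ, HasZeroCauchyData hT (smoothOn.slice ξ F)) :
    HasZeroCauchyData hT (momentumMoment hT R hm F) := by
  have h0 : (0 : ℝ) ∈ Icc 0 T := left_mem_Icc.2 hT.le
  constructor <;> intro x
  · have hpos (ξ : E3) : F.1 ((0, x), ξ) = 0 := (hF ξ).initial x
    simp [momentumMoment_apply hT h0, hpos]
  · have hvel (ξ : E3) : (phaseTimeDeriv hT F).1 ((0, x), ξ) = 0 :=
      (congrArg (fun g : smoothOn (slab T) => g.1 (0, x))
        (smoothOn.slice_dirDeriv (uniqueDiffOn_slab hT) ξ (1, 0) F)).trans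
        ((hF ξ).initial_timeDeriv x)
    rw [← momentumMoment_phaseTimeDeriv, momentumMoment_apply hT h0]
    simp [hvel]

end

/-- The charge density of a distribution function supported in `‖ξ‖ ≤ R`. -/
def chargeMoment (R : ℝ) : phaseFunctions T →ₗ[ℝ] smoothOn (slab T) :=
  momentumMoment hT R (contDiff_const (c := (1 : ℝ)))

/-- The `i`-th component of the current density of a distribution function supported in
`‖ξ‖ ≤ R`. -/
def currentMoment (R : ℝ) (i : Fin 3) : phaseFunctions T →ₗ[ℝ] smoothOn (slab T) :=
  momentumMoment hT R (contDiff_velocity_apply i)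

/-- `F` represents `f` if the two functions agree on `[0, T] × ℝ³ × ℝ³`, and vanish there for
momenta of norm greater than `R`. -/
structure RepresentsKinetic (R : ℝ) (F : phaseFunctions T) (f : ℝ → E3 → E3 → ℝ) : Prop where
  eq : ∀ t ∈ Icc 0 T, ∀ x ξ, f t x ξ = F.1 ((t, x), ξ)
  eq_zero : ∀ t ∈ Icc 0 T, ∀ x ξ, R < ‖ξ‖ → f t x ξ = 0

namespace RepresentsKinetic

variable {F : phaseFunctions T} {f : ℝ → E3 → E3 → ℝ} {t : ℝ}

protected theorem slice (hf : RepresentsKinetic R F f) (ξ : E3) :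
    Represents (smoothOn.slice ξ F) fun t x => f t x ξ :=
  fun t ht x => hf.eq t ht x ξ

theorem contDiff_momentum (hf : RepresentsKinetic R F f) (ht : t ∈ Icc 0 T) (x : E3) :
    ContDiff ℝ ∞ (f t x) := by
  rw [funext (hf.eq t ht x)]
  exact F.2.1.comp_contDiff (contDiff_const.prodMk contDiff_id) fun ξ =>
    mk_mem_prod (mk_mem_slab ht) (mem_univ ξ)

theorem hasCompactSupport_momentum (hf : RepresentsKinetic R F f) (ht : t ∈ Icc 0 T) (x : E3) :
    HasCompactSupport (f t x) :=
  .intro (isCompact_closedBall 0 R) fun ξ hξ =>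
    hf.eq_zero t ht x ξ (by simpa using hξ)

theorem integrable (hf : RepresentsKinetic R F f) (ht : t ∈ Icc 0 T) (x : E3) :
    Integrable fun ξ => f t x ξ :=
  (hf.contDiff_momentum ht x).continuous.integrable_of_hasCompactSupport
    (hf.hasCompactSupport_momentum ht x)

theorem integrable_smul_velocity (hf : RepresentsKinetic R F f) (ht : t ∈ Icc 0 T) (x : E3) :
    Integrable fun ξ => f t x ξ • velocity ξ :=
  ((hf.contDiff_momentum ht x).continuous.smul
    contDiff_velocity.continuous).integrable_of_hasCompactSupport
    (hf.hasCompactSupport_momentum ht x).smul_right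

theorem momentumMoment_apply_eq_integral (hf : RepresentsKinetic R F f) (ht : t ∈ Icc 0 T) (x : E3)
    {m : E3 → ℝ} {hm : ContDiff ℝ ∞ m} :
    (momentumMoment hT R hm F).1 (t, x) = ∫ ξ, m ξ * f t x ξ := by
  simp only [momentumMoment_apply hT ht, ← hf.eq t ht]
  exact setIntegral_eq_integral_of_forall_compl_eq_zero fun ξ hξ => by
    rw [hf.eq_zero t ht x ξ (by simpa using hξ), mul_zero]

protected theorem chargeDensity (hf : RepresentsKinetic R F f) :
    Represents (chargeMoment hT R F) fun t => chargeDensity (f t) := fun t ht x => by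
  simp [chargeMoment, hf.momentumMoment_apply_eq_integral hT ht, VlasovMaxwell.chargeDensity]

protected theorem currentDensity (hf : RepresentsKinetic R F f) :
    RepresentsField (fun i => currentMoment hT R i F) fun t => currentDensity (f t) :=
  fun i t ht x => by
    refine Eq.trans ?_ (hf.momentumMoment_apply_eq_integral hT ht x).symm
    refine (ContinuousLinearMap.integral_comp_comm (EuclideanSpace.proj i : E3 →L[ℝ] ℝ)
      (hf.integrable_smul_velocity ht x)).symm.trans ?_
    simp [mul_comm]

theorem vlasov_transport_apply (hf : RepresentsKinetic R F f) {E B : ℝ → E3 → E3}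
    (hv : VlasovEquation T f E B) (ht : t ∈ Icc 0 T) (x ξ : E3) :
    (phaseTimeDeriv hT F).1 ((t, x), ξ) +
        ∑ i, velocity ξ i * (phasePartial hT i F).1 ((t, x), ξ) =
      -inner ℝ (E t x + cross (velocity ξ) (B t x)) (gradient (f t x) ξ) := by
  have hslice (v : ℝ × E3) := congrArg (fun g : smoothOn (slab T) => g.1 (t, x))
    (smoothOn.slice_dirDeriv (uniqueDiffOn_slab hT) ξ v F)
  have htime : (phaseTimeDeriv hT F).1 ((t, x), ξ) = timeDeriv T (fun s y => f s y ξ) t x :=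
    (hslice _).trans ((hf.slice ξ).timeDeriv hT t ht x).symm
  have hspace (i : Fin 3) : (phasePartial hT i F).1 ((t, x), ξ) =
      partialDeriv i (fun y => f t y ξ) x :=
    (hslice _).trans ((hf.slice ξ).partialDeriv hT i t ht x).symm
  have hinner : inner ℝ (velocity ξ) (gradient (fun y => f t y ξ) x) =
      ∑ i, velocity ξ i * partialDeriv i (fun y => f t y ξ) x := by
    simp only [PiLp.inner_apply, gradient_apply, RCLike.inner_apply, conj_trivial, mul_comm]
  have hvlasov := hv t ht x ξ
  rw [hinner] at hvlasov
  simp only [htime, hspace]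
  linarith

theorem continuity_equation (hf : RepresentsKinetic R F f) {E B : ℝ → E3 → E3}
    (hv : VlasovEquation T f E B) :
    slabTimeDeriv hT (chargeMoment hT R F) +
      formalDiv (slabPartial hT) (fun i => currentMoment hT R i F) = 0 := by
  refine smoothOn.ext fun ⟨t, x⟩ hp => ?_
  have ht : t ∈ Icc 0 T := hp.1
  have hint {m : E3 → ℝ} (hm : ContDiff ℝ ∞ m) (G : phaseFunctions T) :=
    smoothOn.integrableOn_mul_apply volume (isCompact_closedBall 0 R) hm hp G
  have hmoments : (slabTimeDeriv hT (chargeMoment hT R F) +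
      formalDiv (slabPartial hT) (fun i => currentMoment hT R i F)).1 (t, x) =
      ∫ ξ in closedBall 0 R, (1 * (phaseTimeDeriv hT F).1 ((t, x), ξ) +
        ∑ i, velocity ξ i * (phasePartial hT i F).1 ((t, x), ξ)) := by
    rw [integral_add (hint contDiff_const _)
      (integrable_finsetSum _ fun i _ => hint (contDiff_velocity_apply i) _),
      integral_finsetSum _ fun i _ => hint (contDiff_velocity_apply i) _]
    simp [formalDiv, chargeMoment, currentMoment, ← momentumMoment_phaseTimeDeriv,
      ← momentumMoment_phasePartial, momentumMoment_apply hT ht]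
  simp only [hmoments, one_mul, hf.vlasov_transport_apply hT hv ht, integral_neg]
  rw [setIntegral_inner_lorentzForce_gradient ((hf.contDiff_momentum ht x).of_le (by simp))
    (hf.eq_zero t ht x), neg_zero]
  rfl

end RepresentsKinetic

theorem IsSmoothCompactlySupported.exists_representsKinetic {f : ℝ → E3 → E3 → ℝ}
    (hf : IsSmoothCompactlySupported T f) :
    ∃ (R : ℝ) (F : phaseFunctions T), RepresentsKinetic R F f := by
  obtain ⟨K, hK, hfK⟩ := hf.support
  obtain ⟨R, hR⟩ := (hK.image (continuous_snd.comp continuous_snd)).isBounded.exists_norm_le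
  have hsmooth : ContDiffOn ℝ ∞ (fun q : (ℝ × E3) × E3 => f q.1.1 q.1.2 q.2)
      (slab T ×ˢ univ) :=
    hf.smooth.comp (contDiff_fst.fst.prodMk (contDiff_fst.snd.prodMk contDiff_snd)).contDiffOn
      fun q hq => mk_mem_prod hq.1.1 (mem_univ _)
  refine ⟨R, smoothOn.restrict _ hsmooth, fun t ht x ξ => ?_, fun t ht x ξ hξ => ?_⟩
  · exact (smoothOn.restrict_apply (hg := hsmooth) (mk_mem_prod
      (mk_mem_slab ht) (mem_univ ξ))).symm
  · exact hfK (t, x, ξ) (mk_mem_prod ht (mem_univ _)) fun h =>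
      hξ.not_ge (hR ξ (mem_image_of_mem _ h))

theorem IsSmoothCompactlySupported.hasCompactSupport_chargeDensity {f : ℝ → E3 → E3 → ℝ}
    (hf : IsSmoothCompactlySupported T f) {t : ℝ} (ht : t ∈ Icc 0 T) :
    HasCompactSupport (chargeDensity (f t)) := by
  obtain ⟨K, hK, hfK⟩ := hf.support
  refine .intro (hK.image (continuous_fst.comp continuous_snd)) fun x hx => ?_
  have hzero (ξ : E3) : f t x ξ = 0 :=
    hfK (t, x, ξ) (mk_mem_prod ht (mem_univ _)) fun h => hx (mem_image_of_mem _ h)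
  simp [chargeDensity, hzero]

theorem RepresentsKinetic.contDiffOn_of_isWaveSolution (hT : 0 < T) {F : phaseFunctions T}
    {f u : ℝ → E3 → E3 → ℝ} (hf : RepresentsKinetic R F f)
    (hu : ∀ ξ, IsWaveSolution T (fun t x => f t x ξ) (fun _ => 0) (fun _ => 0)
      fun t x => u t x ξ) :
    ContDiffOn ℝ ∞ (fun q : (ℝ × E3) × E3 => u q.1.1 q.1.2 q.2) (slab T ×ˢ univ) := by
  have hretarded (ξ : E3) (t : ℝ) (ht : t ∈ Icc 0 T) (x : E3) :
      u t x ξ = retardedPotential (fun s y => f s y ξ) t x := by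
    have hkirchhoff := (hu ξ).eq_freeWave_add_retardedPotential
      (hf.slice ξ).contDiffOn.continuousOn hT ht x
    simpa [freeWave] using hkirchhoff
  have hsmooth : ContDiffOn ℝ ∞ (fun q : (ℝ × E3) × E3 => f q.1.1 q.1.2 q.2)
      (slab T ×ˢ univ) := F.2.1.congr fun q hq => hf.eq q.1.1 hq.1.1 q.1.2 q.2
  exact (contDiffOn_retardedPotential (h := fun ξ t x => f t x ξ) hT hsmooth).congr
    fun q hq => hretarded q.2 q.1.1 hq.1.1 q.1.2

theorem RepresentsKinetic.exists_formalWave_eq {F : phaseFunctions T}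
    {f u : ℝ → E3 → E3 → ℝ} (hf : RepresentsKinetic R F f)
    (hu : ∀ ξ, IsWaveSolution T (fun t x => f t x ξ) (fun _ => 0) (fun _ => 0)
      fun t x => u t x ξ) :
    ∃ U : phaseFunctions T, RepresentsKinetic R U u ∧
      formalWave (phaseTimeDeriv hT) (phasePartial hT) U = F ∧
      ∀ ξ, HasZeroCauchyData hT (smoothOn.slice ξ U) := by
  have h0 : (0 : ℝ) ∈ Icc 0 T := left_mem_Icc.2 hT.le
  have hsmooth := hf.contDiffOn_of_isWaveSolution hT hu
  set U : phaseFunctions T := smoothOn.restrict _ hsmooth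
  have hU (ξ : E3) : Represents (smoothOn.slice ξ U) fun t x => u t x ξ := fun t ht x =>
    (smoothOn.restrict_apply (hg := hsmooth) (mk_mem_prod (mk_mem_slab ht) (mem_univ ξ))).symm
  have hwave (ξ : E3) : formalWave (slabTimeDeriv hT) (slabPartial hT) (smoothOn.slice ξ U) =
      smoothOn.slice ξ F := formalWave_eq_of_isWaveSolution hT (hU ξ) (hf.slice ξ) (hu ξ)
  have hzero (ξ : E3) : HasZeroCauchyData hT (smoothOn.slice ξ U) :=
    ⟨fun x => (hU ξ 0 h0 x).symm.trans ((hu ξ).initial x),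
      fun x => ((hU ξ).timeDeriv hT 0 h0 x).symm.trans ((hu ξ).initial_timeDeriv x)⟩
  refine ⟨U, ⟨fun t ht x ξ => hU ξ t ht x, fun t ht x ξ hξ => ?_⟩, ?_, hzero⟩
  · have hF : smoothOn.slice ξ F = 0 := smoothOn.ext fun p hp =>
      (hf.eq p.1 hp.1 p.2 ξ).symm.trans (hf.eq_zero p.1 hp.1 p.2 ξ hξ)
    refine (hU ξ t ht x).trans ?_
    rw [(hzero ξ).eq_zero_of_formalWave_eq_zero ((hwave ξ).trans hF)]
    rfl
  · exact smoothOn.ext fun q _ => congrArg (fun g : smoothOn (slab T) => g.1 q.1)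
      ((slice_formalWave hT q.2 U).trans (hwave q.2))

end Kinetic

section Potentials

variable {T : ℝ} {hT : 0 < T} {Φ ρ : smoothOn (slab T)} {A J : Fin 3 → smoothOn (slab T)}
  {φ : ℝ → E3 → ℝ} {a : ℝ → E3 → E3} {f : ℝ → E3 → E3 → ℝ} {fin : E3 → E3 → ℝ}

theorem formalGauge_eq_zero
    (hΦ : formalWave (slabTimeDeriv hT) (slabPartial hT) Φ = ρ)
    (hA : ∀ i, formalWave (slabTimeDeriv hT) (slabPartial hT) (A i) = J i)
    (hcontinuity : slabTimeDeriv hT ρ + formalDiv (slabPartial hT) J = 0)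
    (hA₀ : ∀ i, HasZeroCauchyData hT (A i))
    (hΦ₀ : ∀ x, (slabTimeDeriv hT Φ).1 (0, x) = 0)
    (hpoisson : ∀ x, (∑ i, slabPartial hT i (slabPartial hT i Φ)).1 (0, x) = -ρ.1 (0, x)) :
    formalGauge (slabTimeDeriv hT) (slabPartial hT) Φ A = 0 := by
  have hpartial {g : smoothOn (slab T)} := slabPartial_initial_eq_zero hT (g := g)
  refine HasZeroCauchyData.eq_zero_of_formalWave_eq_zero (hT := hT) ⟨fun x => ?_, fun x => ?_⟩ ?_
  · simp [formalGauge, formalDiv, hΦ₀, hpartial (hA₀ _).initial]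
  · have hcomm (i : Fin 3) : slabTimeDeriv hT (slabPartial hT i (A i)) =
        slabPartial hT i (slabTimeDeriv hT (A i)) :=
      LinearMap.congr_fun (commute_slabTimeDeriv_slabPartial hT i).eq (A i)
    have htime : slabTimeDeriv hT (slabTimeDeriv hT Φ) =
        ρ + ∑ i, slabPartial hT i (slabPartial hT i Φ) := by
      simp [← hΦ, formalWave]
    have hdiv : (∑ i, slabPartial hT i (slabTimeDeriv hT (A i))).1 (0, x) = 0 := by
      simp [hpartial (hA₀ _).initial_timeDeriv]
    rw [formalGauge, formalDiv, map_add, map_sum, htime]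
    simp only [hcomm, Submodule.coe_add, Pi.add_apply, hpoisson, hdiv]
    ring
  · rw [formalWave_formalGauge _ _ (commute_slabTimeDeriv_slabPartial hT) (commute_slabPartial hT),
      hΦ]
    simpa only [hA, formalDiv] using hcontinuity

theorem isVlasovMaxwellSolution_of_formalGauge_eq_zero (hφ : Represents Φ φ)
    (ha : RepresentsField A a) (hρ : Represents ρ fun t => chargeDensity (f t))
    (hJ : RepresentsField J fun t => currentDensity (f t))
    (hΦ : formalWave (slabTimeDeriv hT) (slabPartial hT) Φ = ρ)
    (hA : ∀ i, formalWave (slabTimeDeriv hT) (slabPartial hT) (A i) = J i)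
    (hgauge : formalGauge (slabTimeDeriv hT) (slabPartial hT) Φ A = 0)
    (hf : ContDiffOn ℝ 1 (fun p : ℝ × E3 × E3 => f p.1 p.2.1 p.2.2) (phaseSlab T))
    (hvlasov : VlasovEquation T f (electricField T φ a) (magneticField a)) :
    IsVlasovMaxwellSolution T f (electricField T φ a) (magneticField a) := by
  have hE := RepresentsField.electricField hT hφ ha
  have hB : RepresentsField (formalCurl (slabPartial hT) A) (magneticField a) := ha.curl hT
  have hcomm₀ := commute_slabTimeDeriv_slabPartial hT
  have hcomm := commute_slabPartial hT
  refine ⟨hf, hE.contDiffOn.of_le (by simp), hB.contDiffOn.of_le (by simp), hvlasov,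
    fun t ht x => ?div_B, fun t ht x => ?faraday, fun t ht x => ?gauss, fun t ht x => ?ampere⟩
  case div_B =>
    refine (hB.divergence hT t ht x).trans ?_
    rw [formalDiv_formalCurl A hcomm]
    rfl
  case faraday =>
    ext i
    have hcomponent := congrArg (fun g : smoothOn (slab T) => g.1 (t, x))
      (formalCurl_formalElectric Φ A hcomm₀ hcomm i)
    simpa [hB.timeDeriv hT i t ht x, hE.curl hT i t ht x] using hcomponent
  case gauss =>
    refine (hE.divergence hT t ht x).trans (Eq.trans ?_ (hρ t ht x).symm)
    rw [formalDiv_formalElectric Φ A hcomm₀, hgauge, hΦ, map_zero, sub_zero]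
  case ampere =>
    ext i
    have hcomponent := congrArg (fun g : smoothOn (slab T) => g.1 (t, x))
      (formalElectric_sub_formalCurl Φ A hcomm₀ hcomm i)
    simpa [hE.timeDeriv hT i t ht x, hB.curl hT i t ht x, hJ i t ht x, hA, hgauge]
      using hcomponent

theorem hasElectrostaticInitialData (hφ : φ 0 = newtonPotential (chargeDensity fin))
    (ha : RepresentsField A a) (hA₀ : ∀ i, HasZeroCauchyData hT (A i))
    (hf : ∀ x ξ, f 0 x ξ = fin x ξ) :
    HasElectrostaticInitialData fin f (electricField T φ a) (magneticField a) := by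
  have h0 : (0 : ℝ) ∈ Icc 0 T := left_mem_Icc.2 hT.le
  refine ⟨hf, fun x => ?_, fun x => ?_⟩
  · have htime : timeDeriv T a 0 x = 0 := by
      ext i
      exact (ha.timeDeriv hT i 0 h0 x).trans ((hA₀ i).initial_timeDeriv x)
    rw [electricField, htime, hφ, neg_zero, zero_sub]
  · ext i
    refine (ha.curl hT i 0 h0 x).trans ?_
    simp [formalCurl, slabPartial_initial_eq_zero hT (hA₀ _).initial]

theorem exists_represents_of_isWaveSolution_newtonPotential (hT : 0 < T) {r : E3 → ℝ}
    (hr : ContDiff ℝ ∞ r) (hc : HasCompactSupport r)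
    (hφ : IsWaveSolution T (fun _ _ => 0) (newtonPotential r) (fun _ => 0) φ) :
    ∃ Φ : smoothOn (slab T), Represents Φ φ ∧
      formalWave (slabTimeDeriv hT) (slabPartial hT) Φ = 0 ∧
      (∀ x, (slabTimeDeriv hT Φ).1 (0, x) = 0) ∧
      ∀ x, (∑ i, slabPartial hT i (slabPartial hT i Φ)).1 (0, x) = -r x := by
  have h0 : (0 : ℝ) ∈ Icc 0 T := left_mem_Icc.2 hT.le
  have hsmooth : ContDiffOn ℝ ∞ (Function.uncurry φ) (slab T) :=
    (contDiff_freeWave (contDiff_newtonPotential hr hc) contDiff_const).contDiffOn.congr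
      fun p hp => by
        have hkirchhoff := hφ.eq_freeWave_add_retardedPotential continuousOn_const hT hp.1 p.2
        simpa [retardedPotential, Function.uncurry_def] using hkirchhoff
  have hrep := represents_restrict hsmooth
  refine ⟨_, hrep, ?_, fun x => ?_, fun x => ?_⟩
  · exact formalWave_eq_of_isWaveSolution hT hrep (fun _ _ _ => rfl) hφ
  · exact (hrep.timeDeriv hT 0 h0 x).symm.trans (hφ.initial_timeDeriv x)
  · refine (hrep.laplacian hT 0 h0 x).symm.trans ?_
    dsimp only
    rw [funext hφ.initial, laplacian_newtonPotential (hr.of_le ENat.LEInfty.out) hc]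

theorem RepresentsKinetic.exists_represents_scalarPotential {R : ℝ} {F U : phaseFunctions T}
    {u : ℝ → E3 → E3 → ℝ} {r : E3 → ℝ} (hU : RepresentsKinetic R U u)
    (hUF : formalWave (phaseTimeDeriv hT) (phasePartial hT) U = F)
    (hU₀ : ∀ ξ, HasZeroCauchyData hT (smoothOn.slice ξ U))
    (hr : ContDiff ℝ ∞ r) (hc : HasCompactSupport r)
    (hφ : IsWaveSolution T (fun _ _ => 0) (newtonPotential r) (fun _ => 0) φ) :
    ∃ Φ : smoothOn (slab T), Represents Φ (scalarPotential φ u) ∧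
      formalWave (slabTimeDeriv hT) (slabPartial hT) Φ = chargeMoment hT R F ∧
      (∀ x, (slabTimeDeriv hT Φ).1 (0, x) = 0) ∧
      ∀ x, (∑ i, slabPartial hT i (slabPartial hT i Φ)).1 (0, x) = -r x := by
  obtain ⟨Φ₀, hΦ₀, hwave, htime, hpoisson⟩ :=
    exists_represents_of_isWaveSolution_newtonPotential hT hr hc hφ
  have hΨ : HasZeroCauchyData hT (chargeMoment hT R U) := .momentumMoment hT hU₀
  have hpartial {g : smoothOn (slab T)} := slabPartial_initial_eq_zero hT (g := g)
  refine ⟨Φ₀ + chargeMoment hT R U, fun t ht x =>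
    congrArg₂ (· + ·) (hΦ₀ t ht x) (hU.chargeDensity hT t ht x), ?_, fun x => ?_, fun x => ?_⟩
  · rw [map_add, hwave, zero_add, chargeMoment, ← momentumMoment_formalWave, hUF]
  · simp [htime, hΨ.initial_timeDeriv]
  · rw [← hpoisson]
    simp [Finset.sum_add_distrib, hpartial (hpartial hΨ.initial _)]

end Potentials

end VlasovMaxwell

end

theorem mainTheorem5 (T : ℝ) (hT : 0 < T)
    (fin : E3 → E3 → ℝ) (f u : ℝ → E3 → E3 → ℝ) (φ₀ : ℝ → E3 → ℝ)
    (hf : IsSmoothCompactlySupported T f)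
    (hφ₀ : IsWaveSolution T (fun _ _ => 0) (newtonPotential (chargeDensity fin)) (fun _ => 0) φ₀)
    (hfu : IsScalarSolution T fin φ₀ f u) :
    (∀ t ∈ Icc 0 T, ∀ x : E3,
      Integrable (fun ξ => u t x ξ) ∧ Integrable (fun ξ => u t x ξ • velocity ξ)) ∧
    ContDiffOn ℝ ∞ (fun p : ℝ × E3 => scalarPotential φ₀ u p.1 p.2) (slab T) ∧
    ContDiffOn ℝ ∞ (fun p : ℝ × E3 => vectorPotential u p.1 p.2) (slab T) ∧
    (∀ t ∈ Icc 0 T, ∀ x : E3,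
      timeDeriv T (scalarPotential φ₀ u) t x + divergence (vectorPotential u t) x = 0) ∧
    IsVlasovMaxwellSolution T f
      (electricField T (scalarPotential φ₀ u) (vectorPotential u))
      (magneticField (vectorPotential u)) ∧
    HasElectrostaticInitialData fin f
      (electricField T (scalarPotential φ₀ u) (vectorPotential u))
      (magneticField (vectorPotential u)) := by
  obtain rfl : fin = f 0 := funext₂ fun x ξ => (hfu.initial x ξ).symm
  have h0 : (0 : ℝ) ∈ Icc 0 T := left_mem_Icc.2 hT.le
  obtain ⟨R, F, hF⟩ := hf.exists_representsKinetic
  obtain ⟨U, hU, hUF, hU₀⟩ := hF.exists_formalWave_eq hT hfu.wave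
  have hρ := hF.chargeDensity hT
  obtain ⟨Φ, hφ, hwaveΦ, hΦ₀, hpoisson⟩ := hU.exists_represents_scalarPotential hUF hU₀
    (hρ.contDiff_apply h0) (hf.hasCompactSupport_chargeDensity h0) hφ₀
  have hA : RepresentsField (fun i => currentMoment hT R i U) (vectorPotential u) :=
    hU.currentDensity hT
  have hwaveA (i : Fin 3) : formalWave _ _ (currentMoment hT R i U) = currentMoment hT R i F :=
    hUF ▸ (momentumMoment_formalWave hT U).symm
  have hA₀ (i : Fin 3) : HasZeroCauchyData hT (currentMoment hT R i U) := .momentumMoment hT hU₀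
  have hgauge := formalGauge_eq_zero hwaveΦ hwaveA (hF.continuity_equation hT hfu.vlasov) hA₀ hΦ₀
    fun x => (hpoisson x).trans (congrArg Neg.neg (hρ 0 h0 x))
  refine ⟨fun t ht x => ⟨hU.integrable ht x, hU.integrable_smul_velocity ht x⟩, hφ.contDiffOn,
    hA.contDiffOn, fun t ht x => ?_, ?_, ?_⟩
  · exact congrArg₂ (· + ·) (hφ.timeDeriv hT t ht x) (hA.divergence hT t ht x) |>.trans
      (congrArg (fun g : smoothOn (slab T) => g.1 (t, x)) hgauge)
  · exact isVlasovMaxwellSolution_of_formalGauge_eq_zero hφ hA hρ (hF.currentDensity hT)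
      hwaveΦ hwaveA hgauge (hf.smooth.of_le (by simp)) hfu.vlasov
  · refine hasElectrostaticInitialData (funext fun x => ?_) hA hA₀ hfu.initial
    simp [scalarPotential, hφ₀.initial, (hfu.wave _).initial]
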